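/- Let $s\in(1/2,1)$ and let $2\le k\le N$ be integers. Let $C_s>0$ be the normalizing constant of the one-dimensional fractional Laplacian. For $u:\mathbb R^N\to\mathbb R$ and a unit vector $\xi$ put $$\mathcal I_\xi u(x)=C_s\,\mathrm{P.V.}\int_{-\infty}^{+\infty}\frac{u(x+\tau\xi)-u(x)}{|\tau|^{1+2s}}\,d\tau,\qquad \mathcal I_k^+u(x)=\sup\Big\{\sum_{i=1}^k\mathcal I_{\xi_i}u(x)\Big\},$$ the supremum being over all orthonormal $k$-frames $(\xi_1,\dots,\xi_k)$ in $\mathbb R^N$. For $\gamma\in(0,1)$ let $$c_k(\gamma)=C_s\,\mathrm{P.V.}\int_{-\infty}^{+\infty}\frac{|1+\tau|^{-\gamma}-1}{|\tau|^{1+2s}}\,d\tau+2(k-1)\,C_s\int_0^{+\infty}\frac{(1+\tau^2)^{-\gamma/2}-1}{\tau^{1+2s}}\,d\tau .$$ A function $u:\mathbb R^N\to[0,\infty)$ is a viscosity supersolution of $\mathcal I_k^+u+u^p=0$ in $\mathbb R^N$ if it is lower semicontinuous and, for all $x_0\in\mathbb R^N$, $\delta>0$ and $\varphi\in C^2(B_\delta(x_0))$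 such that $u-\varphi$ attains its minimum over $B_\delta(x_0)$ at $x_0$, $$\sup_{(\xi_i)}\ \sum_{i=1}^k\Big(C_s\,\mathrm{P.V.}\int_{-\delta}^{\delta}\frac{\varphi(x_0+\tau\xi_i)-\varphi(x_0)}{|\tau|^{1+2s}}\,d\tau+C_s\int_{|\tau|\ge\delta}\frac{u(x_0+\tau\xi_i)-u(x_0)}{|\tau|^{1+2s}}\,d\tau\Big)+u(x_0)^p\le 0,$$ where the integrals are taken with values in $[-\infty,+\infty]$ (the principal value as $\int_0^{\delta}[\varphi(x_0+\tau\xi_i)+\varphi(x_0-\tau\xi_i)-2\varphi(x_0)]\,\tau^{-1-2s}\,d\tau$, and $\infty-\infty=-\infty$). Theorem. The function $c_k$ has exactly one zero $\bar\gamma$ in $(0,1)$. For every $p\in\mathbb R$ (with the conventions $0^0=1$ and $0^p=0$ for $p<0$), the equation $$\mathcal I_k^+u+u^p=0\quad\text{in }\mathbb R^N$$ has a nonnegative viscosity supersolution $u\not\equiv0$ if and only if $$p>1+\frac{2s}{\bar\gamma}.$$ -/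

import Mathlib

open MeasureTheory Set

namespace FracTrunc

noncomputable section

/-- The normalizing constant `C_s = C_{1,s}` of the one-dimensional fractional Laplacian,
`C_{1,s} = s 4^s Γ(s + 1/2) / (√π Γ(1 - s)) = (∫_ℝ (1 - cos ζ) |ζ|^{-(1+2s)} dζ)⁻¹`. -/
def Cs (s : ℝ) : ℝ :=
  s * 4 ^ s * Real.Gamma (s + 1 / 2) / (Real.sqrt Real.pi * Real.Gamma (1 - s))

/-- The integral over `A ⊆ ℝ` with values in `[-∞, +∞]`: integral of the positive part minus
integral of the negative part. It is the usual integral when the function is integrable, and `+∞`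
when only the positive part has infinite integral. -/
def eint (A : Set ℝ) (f : ℝ → ℝ) : EReal :=
  ((∫⁻ τ in A, ENNReal.ofReal (f τ) : ENNReal) : EReal)
    - ((∫⁻ τ in A, ENNReal.ofReal (-(f τ)) : ENNReal) : EReal)

variable {N : ℕ}

/-- `C_s P.V. ∫_{-δ}^{δ} [φ(x + τ ξ) - φ(x)] |τ|^{-(1+2s)} dτ`, where the principal value is
written in symmetrized form, as `C_s ∫_0^δ [φ(x + τ ξ) + φ(x - τ ξ) - 2 φ(x)] τ^{-(1+2s)} dτ`. -/
def innerPart (s : ℝ) (φ : EuclideanSpace ℝ (Fin N) → ℝ) (x : EuclideanSpace ℝ (Fin N)) (δ : ℝ)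
    (ξ : EuclideanSpace ℝ (Fin N)) : EReal :=
  eint (Ioo 0 δ) fun τ =>
    Cs s * ((φ (x + τ • ξ) + φ (x - τ • ξ) - 2 * φ x) * τ ^ (-(1 + 2 * s)))

/-- `C_s ∫_{|τ| ≥ δ} [u(x + τ ξ) - u(x)] |τ|^{-(1+2s)} dτ`, a value in `(-∞, +∞]` when `u` is
bounded from below and measurable. -/
def outerPart (s : ℝ) (u : EuclideanSpace ℝ (Fin N) → ℝ) (x : EuclideanSpace ℝ (Fin N)) (δ : ℝ)
    (ξ : EuclideanSpace ℝ (Fin N)) : EReal :=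
  eint {τ | δ ≤ |τ|} fun τ =>
    Cs s * ((u (x + τ • ξ) - u x) * |τ| ^ (-(1 + 2 * s)))

/-- The evaluation `𝓘_k^+(u, φ, x, δ)`: the supremum over all orthonormal `k`-frames `ξ` of the sum
over `i` of the directional operators along `ξ i`, computed with `φ` on `(-δ, δ)` and with `u`
outside. -/
def maxOp (k : ℕ) (s : ℝ) (u φ : EuclideanSpace ℝ (Fin N) → ℝ) (x : EuclideanSpace ℝ (Fin N))
    (δ : ℝ) : EReal :=
  ⨆ ξ : {ξ : Fin k → EuclideanSpace ℝ (Fin N) // Orthonormal ℝ ξ},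
    ∑ i, (innerPart s φ x δ (ξ.1 i) + outerPart s u x δ (ξ.1 i))

/-- `u` is a viscosity supersolution of `𝓘_k^+ u + f(u) = 0` in `ℝ^N`. -/
def IsViscositySupersolution (k : ℕ) (s : ℝ) (f : ℝ → ℝ) (u : EuclideanSpace ℝ (Fin N) → ℝ) :
    Prop :=
  LowerSemicontinuous u ∧
    ∀ (x₀ : EuclideanSpace ℝ (Fin N)) (δ : ℝ) (φ : EuclideanSpace ℝ (Fin N) → ℝ), 0 < δ →
      ContDiffOn ℝ 2 φ (Metric.ball x₀ δ) →
      (∀ y ∈ Metric.ball x₀ δ, u x₀ - φ x₀ ≤ u y - φ y) →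
      maxOp k s u φ x₀ δ + ((f (u x₀) : ℝ) : EReal) ≤ 0

/-- `ĉ(γ) = C_s P.V. ∫_ℝ [|1 + τ|^{-γ} - 1] |τ|^{-(1+2s)} dτ`, with the principal value in
symmetrized form. -/
def cHat (s γ : ℝ) : ℝ :=
  Cs s * ∫ τ in Ioi (0 : ℝ),
    (|1 + τ| ^ (-γ) + |1 - τ| ^ (-γ) - 2) * τ ^ (-(1 + 2 * s))

/-- `c^⊥(γ) = 2 C_s ∫_0^∞ [(1 + τ²)^{-γ/2} - 1] τ^{-(1+2s)} dτ`. -/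
def cPerp (s γ : ℝ) : ℝ :=
  2 * Cs s * ∫ τ in Ioi (0 : ℝ), ((1 + τ ^ 2) ^ (-γ / 2) - 1) * τ ^ (-(1 + 2 * s))

/-- `c_k(γ) = ĉ(γ) + (k - 1) c^⊥(γ)`. -/
def cFun (k : ℕ) (s γ : ℝ) : ℝ := cHat s γ + ((k : ℝ) - 1) * cPerp s γ

end

end FracTrunc

open MeasureTheory Set Filter Topology

namespace FracTrunc

/-! ### Pointwise inequalities for negative powers -/

/-! The exponent is decided by the action of the operator on radial powers. On `|x|^{-γ}`, the frame
containing the radial direction gives `c_k(γ) |x|^{-γ-2s}`. So everything rests on the sign of `c_k`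
and on a comparison of supersolutions with such powers.

Sign of `c_k`. It is convex in `γ`, since `x^{-γ}` is, and it becomes positive near `γ = 1` because
of the singularity of `|1 - τ|^{-γ}`. For `k = 2` its slope at `0` is a negative multiple of `∫
log|1 - τ⁴| τ^{-1-2s}`; larger `k` only adds nonpositive terms. This integral vanishes at `s = 1` by
an explicit primitive and is positive for `s < 1`, because the logarithm changes sign only once
(`integral_log_kernel_pos`). Hence `c_k` is negative and then positive, with a single zero `γ̄`
(`exists_cFun_zero`).

Existence for `p > 1 + 2s/γ̄`. With `γ = 2s/(p-1) < γ̄` the function `c (1 + |x|²)^{-γ/2}` is a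
supersolution. Put `R² = 1 + |x|²` and `θ_i = ⟨x, ξ_i⟩/R`. The second difference along `ξ_i` lies
below the chord in `θ_i²` joining the orthogonal case to the radial one (`rpow_neg_chord`). Since `∑
θ_i² ≤ 1` and the radial increment dominates, every frame gives at most `c R^{-γ-2s} c_k(γ)`, which
a suitable `c` turns into `-u^p`.

Nonexistence otherwise. A nontrivial supersolution is positive. Comparison with `a(|x|^{-γ̄} +
|x|^{-γ'})`, where `c_k(γ') > 0`, cut off near the origin, gives `u ≥ A |x|^{-γ̄}` outside the unit
ball (`exists_lower_bound`). Testing with a paraboloid at scale `R` produces points where `u^p ≤ C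
u(y) R^{-2s}` (`exists_le`). For `p ≤ 1` the two bounds conflict as `R → ∞`, because `2s > 1 > γ̄`.
For `1 < p ≤ 1 + 2s/γ̄` the nonlinear term is strong enough to raise `A` by a fixed amount
repeatedly, so `A` may be taken arbitrarily large (`lower_bound_unbounded`). The paraboloid estimate
then halves the rescaled values `u(y) ρ^{γ̄}` over and over, although they stay above `A > 0`. -/

/-- The symmetrized increment of `|·|^{-γ}` at `1`. -/
noncomputable def hatDiff (γ τ : ℝ) : ℝ := |1 + τ| ^ (-γ) + |1 - τ| ^ (-γ) - 2

/-- The increment of `|·|^{-γ}` at a unit vector in an orthogonal direction. -/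
noncomputable def perpDiff (γ τ : ℝ) : ℝ := (1 + τ ^ 2) ^ (-γ / 2) - 1

lemma rpowIntegrand_inv {α t x : ℝ} (ht : 0 < t) (hx : 0 < x) :
    Real.rpowIntegrand₀₁ α t x⁻¹ = t ^ α * t⁻¹ * (1 + t * x)⁻¹ := by
  have h1 : 0 < 1 + t * x := by positivity
  have h2 : 0 < t + x⁻¹ := by positivity
  rw [Real.rpowIntegrand₀₁, mul_assoc]
  congr 1
  field_simp
  ring

/-- The left side is convex in `θ²`. Writing `x^{-α}` as a positive superposition of resolvents `(1
+ t x)⁻¹` reduces this to a single resolvent, whose symmetric sum is `2/A + 2θ²β²/(A(A² - θ²β²))`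
with `A = 1 + ta`, `β = tb`; replacing `θ²` by `1` in the denominator only increases it. -/
lemma rpow_neg_chord {α a b θ : ℝ} (hα : α ∈ Ioo (0 : ℝ) 1) (hab : |b| < a) (hθ : θ ^ 2 ≤ 1) :
    (a + θ * b) ^ (-α) + (a - θ * b) ^ (-α) ≤
      (1 - θ ^ 2) * (2 * a ^ (-α)) + θ ^ 2 * ((a + b) ^ (-α) + (a - b) ^ (-α)) := by
  obtain ⟨μ, hμ⟩ := Real.exists_measure_rpow_eq_integral_rpowIntegrand₀₁ hα
  have key : ∀ x : ℝ, 0 < x → x ^ (-α) = ∫ t in Ioi 0, Real.rpowIntegrand₀₁ α t x⁻¹ ∂μ := by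
    intro x hx
    rw [← (hμ x⁻¹ (by simpa using hx.le)).2, Real.inv_rpow hx.le, Real.rpow_neg hx.le]
  have ki : ∀ x : ℝ, 0 < x →
      Integrable (fun t => Real.rpowIntegrand₀₁ α t x⁻¹) (μ.restrict (Ioi 0)) :=
    fun x hx => (hμ x⁻¹ (by simpa using hx.le)).1
  have hb := abs_lt.1 hab
  have hθb : |θ * b| < a := by
    rw [abs_mul]
    have : |θ| ≤ 1 := abs_le_one_iff_mul_self_le_one.2 (by nlinarith)
    nlinarith [abs_nonneg b, abs_nonneg θ]
  have hθb' := abs_lt.1 hθb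
  have h1 : 0 < a + θ * b := by linarith
  have h2 : 0 < a - θ * b := by linarith
  have h3 : 0 < a + b := by linarith
  have h4 : 0 < a - b := by linarith
  have h5 : 0 < a := by linarith [abs_nonneg b]
  have i1 : Integrable (fun t => (1 - θ ^ 2) * (2 * Real.rpowIntegrand₀₁ α t a⁻¹))
      (μ.restrict (Ioi 0)) := ((ki _ h5).const_mul _).const_mul _
  have i2 : Integrable (fun t => θ ^ 2 * (Real.rpowIntegrand₀₁ α t (a + b)⁻¹ +
      Real.rpowIntegrand₀₁ α t (a - b)⁻¹)) (μ.restrict (Ioi 0)) :=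
    ((ki _ h3).add (ki _ h4)).const_mul _
  rw [key _ h1, key _ h2, key _ h3, key _ h4, key _ h5, ← integral_add (ki _ h1) (ki _ h2),
    ← integral_add (ki _ h3) (ki _ h4), ← integral_const_mul, ← integral_const_mul,
    ← integral_const_mul, ← integral_add i1 i2]
  refine setIntegral_mono_on ((ki _ h1).add (ki _ h2)) (i1.add i2) measurableSet_Ioi fun t ht => ?_
  have ht : 0 < t := ht
  rw [rpowIntegrand_inv ht h1, rpowIntegrand_inv ht h2, rpowIntegrand_inv ht h3,
    rpowIntegrand_inv ht h4, rpowIntegrand_inv ht h5]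
  have hA : 0 < 1 + t * a := by positivity
  have h1' : 0 < 1 + t * (a + θ * b) := by positivity
  have h2' : 0 < 1 + t * (a - θ * b) := by positivity
  have h3' : 0 < 1 + t * (a + b) := by positivity
  have h4' : 0 < 1 + t * (a - b) := by positivity
  have e1 : (1 + t * (a + θ * b))⁻¹ + (1 + t * (a - θ * b))⁻¹ = 2 * (1 + t * a)⁻¹ +
      2 * θ ^ 2 * (t * b) ^ 2 * ((1 + t * a)⁻¹ *
        ((1 + t * (a + θ * b)) * (1 + t * (a - θ * b)))⁻¹) := by
    field_simp; ring
  have e2 : (1 + t * (a + b))⁻¹ + (1 + t * (a - b))⁻¹ = 2 * (1 + t * a)⁻¹ +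
      2 * (t * b) ^ 2 * ((1 + t * a)⁻¹ * ((1 + t * (a + b)) * (1 + t * (a - b)))⁻¹) := by
    field_simp; ring
  have e3 : ((1 + t * (a + θ * b)) * (1 + t * (a - θ * b)))⁻¹ ≤
      ((1 + t * (a + b)) * (1 + t * (a - b)))⁻¹ := by
    apply inv_anti₀ (by positivity)
    nlinarith [mul_nonneg (sub_nonneg.2 hθ) (sq_nonneg (t * b))]
  have e4 : (1 + t * (a + θ * b))⁻¹ + (1 + t * (a - θ * b))⁻¹ ≤ (1 - θ ^ 2) * (2 * (1 + t * a)⁻¹)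
      + θ ^ 2 * ((1 + t * (a + b))⁻¹ + (1 + t * (a - b))⁻¹) := by
    rw [e1, e2]
    have : 2 * θ ^ 2 * (t * b) ^ 2 * ((1 + t * a)⁻¹ *
        ((1 + t * (a + θ * b)) * (1 + t * (a - θ * b)))⁻¹) ≤ 2 * θ ^ 2 * (t * b) ^ 2 *
        ((1 + t * a)⁻¹ * ((1 + t * (a + b)) * (1 + t * (a - b)))⁻¹) := by gcongr
    linarith
  have := mul_le_mul_of_nonneg_left e4 (show 0 ≤ t ^ α * t⁻¹ by positivity)
  linarith

lemma abs_rpow_neg_eq (γ y : ℝ) : |y| ^ (-γ) = (y ^ 2) ^ (-γ / 2) := by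
  rw [← sq_abs, ← Real.rpow_natCast, ← Real.rpow_mul (abs_nonneg y)]
  congr 1; push_cast; ring

/-- Away from `τ = 1` the radial increment dominates the orthogonal one. -/
lemma two_mul_perpDiff_le_hatDiff {γ τ : ℝ} (hγ : 0 < γ) (h1 : τ ≠ 1) (h2 : τ ≠ -1) :
    2 * perpDiff γ τ ≤ hatDiff γ τ := by
  have hp : 0 < |1 + τ| := abs_pos.2 fun h => h2 (by linarith)
  have hm : 0 < |1 - τ| := abs_pos.2 fun h => h1 (by linarith)
  -- Since `|1 - τ²| ≤ 1 + τ²`, the product of the two radial powers dominates the square of the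
  -- orthogonal one; the arithmetic-geometric mean inequality concludes. At `τ = ±1` the convention
  -- `0 ^ (-γ) = 0` would spoil this.
  have hsq : ((1 + τ ^ 2) ^ (-γ / 2)) ^ 2 ≤ |1 + τ| ^ (-γ) * |1 - τ| ^ (-γ) := by
    rw [← Real.mul_rpow hp.le hm.le, ← abs_mul, abs_rpow_neg_eq, ← Real.rpow_natCast,
      ← Real.rpow_mul (by positivity), mul_comm (-γ / 2), Real.rpow_mul (by positivity)]
    apply Real.rpow_le_rpow_of_nonpos
    · have : (1 + τ) * (1 - τ) ≠ 0 := by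
        rw [← abs_pos, abs_mul]; positivity
      positivity
    · rw [Real.rpow_natCast]; nlinarith [sq_nonneg τ]
    · linarith
  have : (2 * (1 + τ ^ 2) ^ (-γ / 2)) ^ 2 ≤ (|1 + τ| ^ (-γ) + |1 - τ| ^ (-γ)) ^ 2 := by
    nlinarith [sq_nonneg (|1 + τ| ^ (-γ) - |1 - τ| ^ (-γ))]
  have := abs_le_of_sq_le_sq' this (by positivity)
  unfold perpDiff hatDiff
  linarith [this.2]

lemma perpDiff_nonpos {γ : ℝ} (hγ : 0 ≤ γ) (τ : ℝ) : perpDiff γ τ ≤ 0 := by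
  have := Real.rpow_le_one_of_one_le_of_nonpos (show 1 ≤ 1 + τ ^ 2 by nlinarith [sq_nonneg τ])
    (show -γ / 2 ≤ 0 by linarith)
  unfold perpDiff; linarith

/-- Bernoulli's inequality for `(1 + τ²)^{γ/2}`. The bound is integrable against the kernel at `0`
because `s < 1` and at infinity because `s > 0`; it does not depend on `γ`. -/
lemma neg_min_le_perpDiff {γ : ℝ} (hγ : γ ∈ Ioo (0 : ℝ) 1) (τ : ℝ) :
    -min (τ ^ 2) 1 ≤ perpDiff γ τ := by
  have h0 : (0 : ℝ) < 1 + τ ^ 2 := by positivity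
  have hp : 0 < (1 + τ ^ 2) ^ (-γ / 2) := by positivity
  rw [neg_le]
  refine le_min ?_ (by unfold perpDiff; linarith)
  have h2 : (1 + τ ^ 2) ^ (-γ / 2) * (1 + τ ^ 2) ^ (γ / 2) = 1 := by
    rw [← Real.rpow_add h0]; ring_nf; simp
  have h3 : (1 + τ ^ 2) ^ (γ / 2) ≤ 1 + γ / 2 * τ ^ 2 :=
    rpow_one_add_le_one_add_mul_self (by nlinarith [sq_nonneg τ]) (by linarith [hγ.1])
      (by linarith [hγ.2])
  unfold perpDiff
  nlinarith [mul_le_mul_of_nonneg_left h3 hp.le, sq_nonneg τ, hγ.1, hγ.2,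
    mul_nonneg (sub_nonneg.2 hγ.2.le) (sq_nonneg τ), mul_nonneg hγ.1.le (sq_nonneg τ)]

lemma rpow_neg_le_bernoulli {γ x : ℝ} (hγ : γ ∈ Ioo (0 : ℝ) 1) (hx : 0 < x) :
    x ^ (-γ) ≤ 1 + γ * (x⁻¹ - 1) := by
  have hi : 0 < x⁻¹ := inv_pos.2 hx
  have := rpow_one_add_le_one_add_mul_self (s := x⁻¹ - 1) (by linarith) hγ.1.le hγ.2.le
  rwa [add_sub_cancel, Real.inv_rpow hx.le, ← Real.rpow_neg hx.le] at this

/-- Bernoulli in terms of `x⁻¹` makes the first-order terms cancel: `(1+τ)⁻¹ + (1-τ)⁻¹ - 2 =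
2τ²/(1-τ²)`. -/
lemma hatDiff_le {γ τ : ℝ} (hγ : γ ∈ Ioo (0 : ℝ) 1) (h0 : 0 < τ) (h1 : τ ≤ 1 / 2) :
    hatDiff γ τ ≤ 4 * τ ^ 2 := by
  have hp : 0 < 1 + τ := by linarith
  have hm : 0 < 1 - τ := by linarith
  unfold hatDiff
  rw [abs_of_pos hp, abs_of_pos hm]
  have a1 := rpow_neg_le_bernoulli hγ hp
  have a2 := rpow_neg_le_bernoulli hγ hm
  have a3 : (1 + τ)⁻¹ + (1 - τ)⁻¹ - 2 = 2 * τ ^ 2 * ((1 + τ) * (1 - τ))⁻¹ := by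
    field_simp; ring
  have a4 : ((1 + τ) * (1 - τ))⁻¹ ≤ 2 := by
    rw [show (2 : ℝ) = (1 / 2)⁻¹ by norm_num]
    apply inv_anti₀ (by norm_num); nlinarith
  have a5 : 0 ≤ (1 + τ)⁻¹ + (1 - τ)⁻¹ - 2 := by rw [a3]; positivity
  have a6 : (1 + τ)⁻¹ + (1 - τ)⁻¹ - 2 ≤ 4 * τ ^ 2 := by rw [a3]; nlinarith [sq_nonneg τ]
  nlinarith [hγ.1, hγ.2]

end FracTrunc

namespace FracTrunc

/-! ### Integrability against the kernel `τ^{-(1+2s)}` -/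

section Kernel

variable {s : ℝ}

lemma integrableOn_kernel (hs : 0 < s) {δ : ℝ} (hδ : 0 < δ) :
    IntegrableOn (fun τ : ℝ => τ ^ (-(1 + 2 * s))) (Ioi δ) :=
  integrableOn_Ioi_rpow_of_lt (by linarith) hδ

lemma integrableOn_min_kernel (hs : 0 < s) (hs1 : s < 1) :
    IntegrableOn (fun τ : ℝ => min (τ ^ 2) 1 * τ ^ (-(1 + 2 * s))) (Ioi 0) := by
  rw [← Ioc_union_Ioi_eq_Ioi zero_le_one]
  refine IntegrableOn.union ?_ ?_
  · have h : IntegrableOn (fun τ : ℝ => τ ^ (1 - 2 * s)) (Ioc 0 1) :=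
      (intervalIntegrable_iff_integrableOn_Ioc_of_le zero_le_one).1
        (intervalIntegral.intervalIntegrable_rpow' (by linarith))
    refine h.congr_fun (fun τ hτ => ?_) measurableSet_Ioc
    have h2 : 1 - 2 * s = ((2 : ℕ) : ℝ) + -(1 + 2 * s) := by push_cast; ring
    beta_reduce
    rw [min_eq_left (by nlinarith [hτ.1, hτ.2]), h2, Real.rpow_add hτ.1, Real.rpow_natCast]
  · refine (integrableOn_kernel hs one_pos).congr_fun (fun τ hτ => ?_) measurableSet_Ioi
    have : (1 : ℝ) < τ := hτ
    rw [min_eq_right (by nlinarith), one_mul]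

lemma integrableOn_abs_rpow_ball {γ : ℝ} (hγ1 : γ < 1) (b : ℝ) :
    IntegrableOn (fun τ : ℝ => |b + τ| ^ (-γ)) (Icc (-b - 1) (-b + 1)) := by
  have h0 : IntegrableOn (fun τ : ℝ => |τ| ^ (-γ)) (Icc (-1) 1) := by
    rw [← Icc_union_Icc_eq_Icc (show (-1 : ℝ) ≤ 0 by norm_num) zero_le_one]
    have h1 : IntegrableOn (fun τ : ℝ => τ ^ (-γ)) (Icc 0 1) :=
      (intervalIntegrable_iff_integrableOn_Icc_of_le zero_le_one).1
        (intervalIntegral.intervalIntegrable_rpow' (by linarith))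
    have h2 : IntegrableOn (fun τ : ℝ => |τ| ^ (-γ)) (Icc 0 1) :=
      h1.congr_fun (fun τ hτ => by simp only [abs_of_nonneg hτ.1]) measurableSet_Icc
    refine IntegrableOn.union ?_ h2
    have := h2.comp_neg
    simpa using this
  have := (measurePreserving_add_left volume b).integrableOn_comp_preimage
    (measurableEmbedding_addLeft b) (f := fun τ : ℝ => |τ| ^ (-γ)) (s := Icc (-1) 1)
  have h2 := this.2 h0
  refine (h2.congr_set_ae ?_)
  rw [preimage_const_add_Icc]
  apply Eventually.of_forall; intro x; congr 1 <;> ring_nf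

/-- Within distance `1` of the singularity `-b` the kernel is bounded and `γ < 1` gives
integrability; elsewhere the power is at most `1`. -/
lemma integrableOn_abs_rpow_mul_kernel (hs : 0 < s) {γ : ℝ} (hγ : γ ∈ Ioo (0 : ℝ) 1) (b : ℝ)
    {δ : ℝ} (hδ : 0 < δ) :
    IntegrableOn (fun τ : ℝ => |b + τ| ^ (-γ) * τ ^ (-(1 + 2 * s))) (Ioi δ) := by
  have h1 : Integrable ((Icc (-b - 1) (-b + 1)).indicator fun τ : ℝ => |b + τ| ^ (-γ)) :=
    (integrableOn_abs_rpow_ball hγ.2 b).integrable_indicator measurableSet_Icc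
  have h2 := ((h1.const_mul (δ ^ (-(1 + 2 * s)))).integrableOn (s := Ioi δ)).add
    (integrableOn_kernel hs hδ)
  refine h2.mono' (by fun_prop) ?_
  refine (ae_restrict_mem measurableSet_Ioi).mono fun τ hτ => ?_
  have hτ : δ < τ := hτ
  have hτ0 : 0 < τ := hδ.trans hτ
  have hk : 0 < τ ^ (-(1 + 2 * s)) := Real.rpow_pos_of_pos hτ0 _
  have hx : 0 ≤ |b + τ| ^ (-γ) := Real.rpow_nonneg (abs_nonneg _) _
  rw [Real.norm_of_nonneg (by positivity)]
  simp only [Pi.add_apply]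
  by_cases hm : τ ∈ Icc (-b - 1) (-b + 1)
  · rw [indicator_of_mem hm]
    have : τ ^ (-(1 + 2 * s)) ≤ δ ^ (-(1 + 2 * s)) :=
      Real.rpow_le_rpow_of_nonpos hδ hτ.le (by linarith)
    nlinarith
  · rw [indicator_of_notMem hm, mul_zero, zero_add]
    have h3 : 1 ≤ |b + τ| := by
      by_contra! hc
      have := abs_lt.1 hc
      exact hm ⟨by linarith, by linarith⟩
    have := Real.rpow_le_one_of_one_le_of_nonpos h3 (show -γ ≤ 0 by linarith [hγ.1])
    nlinarith

lemma measurable_hatDiff (γ : ℝ) : Measurable (hatDiff γ) := by unfold hatDiff; fun_prop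

lemma measurable_perpDiff (γ : ℝ) : Measurable (perpDiff γ) := by unfold perpDiff; fun_prop

lemma integrableOn_perpDiff (hs : 0 < s) (hs1 : s < 1) {γ : ℝ} (hγ : γ ∈ Ioo (0 : ℝ) 1) :
    IntegrableOn (fun τ : ℝ => perpDiff γ τ * τ ^ (-(1 + 2 * s))) (Ioi 0) := by
  refine (integrableOn_min_kernel hs hs1).mono'
    ((measurable_perpDiff γ).mul (by fun_prop)).aestronglyMeasurable ?_
  refine (ae_restrict_mem measurableSet_Ioi).mono fun τ hτ => ?_
  have hk : 0 < τ ^ (-(1 + 2 * s)) := Real.rpow_pos_of_pos hτ _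
  rw [norm_mul, Real.norm_of_nonneg hk.le, Real.norm_of_nonpos (perpDiff_nonpos hγ.1.le τ)]
  gcongr
  linarith [neg_min_le_perpDiff hγ τ]

lemma integrableOn_hatDiff (hs : 0 < s) (hs1 : s < 1) {γ : ℝ} (hγ : γ ∈ Ioo (0 : ℝ) 1) :
    IntegrableOn (fun τ : ℝ => hatDiff γ τ * τ ^ (-(1 + 2 * s))) (Ioi 0) := by
  rw [← Ioc_union_Ioi_eq_Ioi (show (0 : ℝ) ≤ 1 / 2 by norm_num)]
  refine IntegrableOn.union ?_ ?_
  · refine (IntegrableOn.mono_set ((integrableOn_min_kernel hs hs1).const_mul 4)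
      Ioc_subset_Ioi_self).mono'
      ((measurable_hatDiff γ).mul (by fun_prop)).aestronglyMeasurable ?_
    refine (ae_restrict_mem measurableSet_Ioc).mono fun τ hτ => ?_
    have hk : 0 < τ ^ (-(1 + 2 * s)) := Real.rpow_pos_of_pos hτ.1 _
    rw [norm_mul, Real.norm_of_nonneg hk.le, ← mul_assoc]
    gcongr
    have h1 := two_mul_perpDiff_le_hatDiff hγ.1 (show τ ≠ 1 by linarith [hτ.2])
      (show τ ≠ -1 by linarith [hτ.1])
    have h2 := neg_min_le_perpDiff hγ τ
    have h3 := hatDiff_le hγ hτ.1 hτ.2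
    rw [min_eq_left (by nlinarith [hτ.1, hτ.2])] at h2 ⊢
    rw [Real.norm_eq_abs, abs_le]
    constructor <;> nlinarith [sq_nonneg τ]
  · have h1 := integrableOn_abs_rpow_mul_kernel hs hγ 1 (show (0 : ℝ) < 1 / 2 by norm_num)
    have h2 := integrableOn_abs_rpow_mul_kernel hs hγ (-1) (show (0 : ℝ) < 1 / 2 by norm_num)
    have h3 := (integrableOn_kernel hs (show (0 : ℝ) < 1 / 2 by norm_num)).const_mul 2
    refine ((h1.add h2).sub h3).congr_fun (fun τ _ => ?_) measurableSet_Ioi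
    simp only [Pi.add_apply, Pi.sub_apply, hatDiff]
    rw [show |-1 + τ| = |1 - τ| by rw [abs_sub_comm]; congr 1; ring]
    ring

lemma comp_div_mul_kernel (h : ℝ → ℝ) {r τ : ℝ} (hr : 0 < r) (hτ : 0 < τ) :
    h (τ / r) * τ ^ (-(1 + 2 * s)) =
      r ^ (-(1 + 2 * s)) * (h (r⁻¹ * τ) * (r⁻¹ * τ) ^ (-(1 + 2 * s))) := by
  rw [Real.mul_rpow (inv_pos.2 hr).le hτ.le, Real.inv_rpow hr.le, div_eq_inv_mul]
  have : 0 < r ^ (-(1 + 2 * s)) := Real.rpow_pos_of_pos hr _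
  field_simp

lemma integrableOn_comp_div_kernel {h : ℝ → ℝ} {r : ℝ} (hr : 0 < r)
    (hi : IntegrableOn (fun τ : ℝ => h τ * τ ^ (-(1 + 2 * s))) (Ioi 0)) :
    IntegrableOn (fun τ : ℝ => h (τ / r) * τ ^ (-(1 + 2 * s))) (Ioi 0) := by
  have h1 := (integrableOn_Ioi_comp_mul_left_iff (fun τ : ℝ => h τ * τ ^ (-(1 + 2 * s))) 0
    (inv_pos.2 hr)).2 (by simpa using hi)
  exact IntegrableOn.congr_fun (h1.const_mul (r ^ (-(1 + 2 * s))))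
    (fun τ hτ => (comp_div_mul_kernel h hr hτ).symm) measurableSet_Ioi

lemma integral_comp_div_kernel (h : ℝ → ℝ) {r : ℝ} (hr : 0 < r) :
    ∫ τ in Ioi (0 : ℝ), h (τ / r) * τ ^ (-(1 + 2 * s)) =
      r ^ (-(2 * s)) * ∫ τ in Ioi (0 : ℝ), h τ * τ ^ (-(1 + 2 * s)) := by
  rw [setIntegral_congr_fun measurableSet_Ioi fun τ hτ => comp_div_mul_kernel h hr hτ,
    integral_const_mul,
    integral_comp_mul_left_Ioi (fun τ : ℝ => h τ * τ ^ (-(1 + 2 * s))) 0 (inv_pos.2 hr)]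
  rw [mul_zero, inv_inv, smul_eq_mul, ← mul_assoc]
  congr 1
  nth_rewrite 2 [← Real.rpow_one r]
  rw [← Real.rpow_add hr]; congr 1; ring

end Kernel

end FracTrunc

namespace FracTrunc

/-! ### The integral of `log |1 - τ⁴|` against the kernel -/

section LogIntegral

lemma abs_log_one_sub_pow_four_le {τ : ℝ} (h0 : 0 < τ) (h1 : τ ≤ 1 / 2) :
    |Real.log (1 - τ ^ 4)| ≤ 2 * τ ^ 4 := by
  have h4 : τ ^ 4 ≤ 1 / 2 := by
    calc τ ^ 4 ≤ (1 / 2) ^ 4 := by gcongr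
      _ ≤ 1 / 2 := by norm_num
  have hpos : 0 < 1 - τ ^ 4 := by linarith
  have ht : 0 < τ ^ 4 := by positivity
  rw [abs_of_nonpos (Real.log_nonpos hpos.le (by linarith)), ← Real.log_inv]
  refine (Real.log_le_sub_one_of_pos (inv_pos.2 hpos)).trans ?_
  have : (1 - τ ^ 4)⁻¹ - 1 = τ ^ 4 * (1 - τ ^ 4)⁻¹ := by field_simp; ring
  rw [this, mul_comm]
  have h2 : (1 - τ ^ 4)⁻¹ ≤ 2 := by
    rw [show (2 : ℝ) = (1 / 2)⁻¹ by norm_num]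
    exact inv_anti₀ (by norm_num) (by linarith)
  gcongr

/-- Both logarithmic divergences, at `1` and at infinity, are traded for powers `1/2` through `log y
≤ 2 y^{1/2}`, which the kernel can integrate. -/
lemma abs_log_one_sub_pow_four_le' {τ : ℝ} (h0 : 1 / 2 < τ) (h1 : τ ≠ 1) :
    |Real.log (1 - τ ^ 4)| ≤ 16 * τ ^ (1 / 2 : ℝ) + 2 * |-1 + τ| ^ (-(1 / 2) : ℝ) := by
  have hτ : 0 < τ := by linarith
  have hm : 0 < |-1 + τ| := abs_pos.2 fun h => h1 (by linarith)
  have hf : |1 - τ ^ 4| = |-1 + τ| * ((1 + τ) * (1 + τ ^ 2)) := by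
    rw [← abs_of_pos (show 0 < (1 + τ) * (1 + τ ^ 2) by positivity), ← abs_mul, ← abs_neg]
    congr 1; ring
  have hlo : |-1 + τ| ≤ |1 - τ ^ 4| := by
    rw [hf]; nlinarith [show 1 ≤ (1 + τ) * (1 + τ ^ 2) by nlinarith [sq_nonneg τ]]
  have hup : |1 - τ ^ 4| ≤ (1 + τ) ^ 4 := by
    rw [abs_le]
    have : 0 < τ ^ 2 := by positivity
    have : 0 < τ ^ 3 := by positivity
    have : 0 < τ ^ 4 := by positivity
    constructor <;> nlinarith
  have hpow : 0 < |-1 + τ| ^ (-(1 / 2) : ℝ) := Real.rpow_pos_of_pos hm _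
  have hpow' : 0 < τ ^ (1 / 2 : ℝ) := Real.rpow_pos_of_pos hτ _
  rw [abs_le, ← Real.log_abs]
  constructor
  · have a1 := Real.log_le_log hm hlo
    have a2 := Real.log_le_rpow_div (inv_pos.2 hm).le (show (0 : ℝ) < 1 / 2 by norm_num)
    rw [Real.log_inv, Real.inv_rpow hm.le, ← Real.rpow_neg hm.le] at a2
    linarith
  · have a1 := Real.log_le_log (hm.trans_le hlo) hup
    rw [Real.log_pow] at a1
    have a2 := Real.log_le_rpow_div (show 0 ≤ 1 + τ by linarith) (show (0 : ℝ) < 1 / 2 by norm_num)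
    have a3 : (1 + τ) ^ (1 / 2 : ℝ) ≤ (4 * τ) ^ (1 / 2 : ℝ) :=
      Real.rpow_le_rpow (by linarith) (by linarith) (by norm_num)
    have a4 : (4 : ℝ) ^ (1 / 2 : ℝ) = 2 := by
      rw [← Real.sqrt_eq_rpow, show (4 : ℝ) = 2 ^ 2 by norm_num, Real.sqrt_sq (by norm_num)]
    rw [Real.mul_rpow (by norm_num) hτ.le, a4] at a3
    push_cast at a1
    linarith

lemma integrableOn_log_kernel {s : ℝ} (hs : 1 / 2 < s) (hs1 : s ≤ 1) :
    IntegrableOn (fun τ : ℝ => Real.log (1 - τ ^ 4) * τ ^ (-(1 + 2 * s))) (Ioi 0) := by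
  rw [← Ioc_union_Ioi_eq_Ioi (show (0 : ℝ) ≤ 1 / 2 by norm_num)]
  have hmeas : Measurable fun τ : ℝ => Real.log (1 - τ ^ 4) * τ ^ (-(1 + 2 * s)) :=
    (Real.measurable_log.comp (by fun_prop)).mul (by fun_prop)
  refine IntegrableOn.union ?_ ?_
  · refine Integrable.mono' (g := fun _ => 2) (by simp) hmeas.aestronglyMeasurable ?_
    refine (ae_restrict_mem measurableSet_Ioc).mono fun τ hτ => ?_
    have hk : 0 < τ ^ (-(1 + 2 * s)) := Real.rpow_pos_of_pos hτ.1 _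
    rw [norm_mul, Real.norm_of_nonneg hk.le, Real.norm_eq_abs]
    calc |Real.log (1 - τ ^ 4)| * τ ^ (-(1 + 2 * s))
        ≤ 2 * τ ^ 4 * τ ^ (-(1 + 2 * s)) := by
          gcongr; exact abs_log_one_sub_pow_four_le hτ.1 hτ.2
      _ = 2 * τ ^ (3 - 2 * s) := by
          rw [show 3 - 2 * s = ((4 : ℕ) : ℝ) + -(1 + 2 * s) by push_cast; ring,
            Real.rpow_add hτ.1, Real.rpow_natCast]; ring
      _ ≤ 2 := by
          have := Real.rpow_le_one hτ.1.le (show τ ≤ 1 by linarith [hτ.2])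
            (show 0 ≤ 3 - 2 * s by linarith)
          linarith
  · have i1 : IntegrableOn (fun τ : ℝ => τ ^ (1 / 2 - (1 + 2 * s))) (Ioi (1 / 2)) :=
      integrableOn_Ioi_rpow_of_lt (by linarith) (by norm_num)
    have i2 := integrableOn_abs_rpow_mul_kernel (s := s) (by linarith)
      (show (1 / 2 : ℝ) ∈ Ioo (0 : ℝ) 1 by constructor <;> norm_num) (-1)
      (show (0 : ℝ) < 1 / 2 by norm_num)
    refine Integrable.mono' ((i1.const_mul 16).add (i2.const_mul 2)) hmeas.aestronglyMeasurable ?_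
    filter_upwards [ae_restrict_mem measurableSet_Ioi,
      ae_restrict_of_ae (Measure.ae_ne volume (1 : ℝ))] with τ hτ h1
    have hτ' : 1 / 2 < τ := hτ
    have hτ0 : 0 < τ := by linarith
    have hk : 0 < τ ^ (-(1 + 2 * s)) := Real.rpow_pos_of_pos hτ0 _
    rw [norm_mul, Real.norm_of_nonneg hk.le, Real.norm_eq_abs]
    have := mul_le_mul_of_nonneg_right (abs_log_one_sub_pow_four_le' hτ' h1) hk.le
    refine this.trans_eq ?_
    simp only [Pi.add_apply]
    rw [sub_eq_add_neg, Real.rpow_add hτ0]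
    ring

/-- `x ↦ (1 - x) log |1 - x| + (1 + x) log (1 + x)`. -/
noncomputable def logEntropy (x : ℝ) : ℝ :=
  (1 - x) * Real.log (1 - x) + (1 + x) * Real.log (1 + x)

lemma continuous_logEntropy : Continuous logEntropy :=
  (Real.continuous_mul_log.comp (continuous_const.sub continuous_id)).add
    (Real.continuous_mul_log.comp (continuous_const.add continuous_id))

lemma hasDerivAt_logEntropy {x : ℝ} (h1 : x ≠ 1) (h2 : x ≠ -1) :
    HasDerivAt logEntropy (Real.log (1 + x) - Real.log (1 - x)) x := by
  have a1 := (Real.hasDerivAt_mul_log (show 1 - x ≠ 0 from fun h => h1 (by linarith))).comp x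
    ((hasDerivAt_id x).const_sub 1)
  have a2 := (Real.hasDerivAt_mul_log (show 1 + x ≠ 0 from fun h => h2 (by linarith))).comp x
    ((hasDerivAt_id x).const_add 1)
  refine (a1.add a2).congr_deriv ?_
  ring

/-- A primitive of `τ ↦ log |1 - τ⁴| τ⁻³`. -/
noncomputable def logPrimitive (τ : ℝ) : ℝ := -(1 / 2) * (logEntropy (τ ^ 2) / τ ^ 2)

lemma hasDerivAt_logPrimitive {τ : ℝ} (h0 : 0 < τ) (h1 : τ ≠ 1) :
    HasDerivAt logPrimitive (Real.log (1 - τ ^ 4) * τ ^ (-(1 + 2 * 1) : ℝ)) τ := by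
  have hsq : HasDerivAt (fun τ : ℝ => τ ^ 2) (2 * τ) τ := by simpa using hasDerivAt_pow 2 τ
  have hne : τ ^ 2 ≠ 1 := fun h => h1 (by nlinarith)
  have hne' : τ ^ 2 ≠ -1 := by nlinarith
  have a1 := HasDerivAt.comp (h := fun τ : ℝ => τ ^ 2) τ (hasDerivAt_logEntropy hne hne') hsq
  have a2 := (a1.div hsq (by positivity)).const_mul (-(1 / 2) : ℝ)
  -- With `x = τ²` the identity is `(-E/x)' = (log|1-x| + log(1+x))/x²` for `E = logEntropy`.
  refine a2.congr_deriv ?_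
  have e1 : (1 : ℝ) - τ ^ 4 = (1 - τ ^ 2) * (1 + τ ^ 2) := by ring
  rw [e1, Real.log_mul (sub_ne_zero.2 hne.symm) (by positivity)]
  have e2 : τ ^ (-(1 + 2 * 1) : ℝ) = (τ ^ 3)⁻¹ := by
    rw [show (-(1 + 2 * 1) : ℝ) = -((3 : ℕ) : ℝ) by norm_num, Real.rpow_neg h0.le,
      Real.rpow_natCast]
  rw [e2]
  simp only [Function.comp, logEntropy]
  field_simp
  ring

lemma tendsto_logPrimitive_zero : Tendsto logPrimitive (𝓝[>] 0) (𝓝 0) := by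
  have h := (hasDerivAt_logEntropy (x := 0) (by norm_num) (by norm_num)).tendsto_slope_zero
  have hsq : Tendsto (fun τ : ℝ => τ ^ 2) (𝓝[>] 0) (𝓝[≠] 0) := by
    refine tendsto_nhdsWithin_iff.2 ⟨?_, ?_⟩
    · have : Tendsto (fun τ : ℝ => τ ^ 2) (𝓝 0) (𝓝 (0 ^ 2)) := (continuous_pow 2).tendsto 0
      simpa using this.mono_left nhdsWithin_le_nhds
    · filter_upwards [self_mem_nhdsWithin] with τ hτ
      have : (0 : ℝ) < τ := hτ
      simp [this.ne']
  have h2 := (h.comp hsq).const_mul (-(1 / 2) : ℝ)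
  have e0 : logEntropy 0 = 0 := by simp [logEntropy]
  simp only [sub_zero, add_zero, Real.log_one, sub_self, mul_zero] at h2
  refine h2.congr fun τ => ?_
  simp only [Function.comp, zero_add, e0, sub_zero, logPrimitive, smul_eq_mul]
  ring

lemma continuousAt_logPrimitive {τ : ℝ} (h0 : 0 < τ) : ContinuousAt logPrimitive τ := by
  have hsq : ContinuousAt (fun τ : ℝ => τ ^ 2) τ := by fun_prop
  exact continuousAt_const.mul
    ((continuous_logEntropy.continuousAt.comp hsq).div hsq (by positivity))

/-- `logEntropy x` grows only logarithmically, since `(x - 1) log((x + 1)/(x - 1))` stays bounded;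
the cruder bound `6τ` with `x = τ²` is enough. -/
lemma tendsto_logPrimitive_atTop : Tendsto logPrimitive atTop (𝓝 0) := by
  have hlim : Tendsto (fun τ : ℝ => 10 * τ⁻¹) atTop (𝓝 0) := by
    simpa using tendsto_inv_atTop_zero.const_mul (10 : ℝ)
  refine squeeze_zero_norm' ?_ hlim
  filter_upwards [eventually_gt_atTop (1 : ℝ)] with τ hτ
  set x := τ ^ 2 with hx
  have hx1 : 1 < x := by nlinarith
  have e : logEntropy x = 2 * Real.log (1 + x) + (x - 1) * Real.log (1 + 2 / (x - 1)) := by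
    have : 1 + 2 / (x - 1) = (1 + x) / (x - 1) := by
      have h : x - 1 ≠ 0 := by linarith
      field_simp
      ring
    rw [this, Real.log_div (by linarith) (by linarith), logEntropy, ← Real.log_neg_eq_log (1 - x)]
    rw [show -(1 - x) = x - 1 by ring]
    ring
  have b1 : 0 ≤ Real.log (1 + x) := Real.log_nonneg (by linarith)
  have hq : 0 < 2 / (x - 1) := div_pos two_pos (by linarith)
  have b2 : 0 ≤ Real.log (1 + 2 / (x - 1)) := Real.log_nonneg (by linarith)
  have b3 : (x - 1) * Real.log (1 + 2 / (x - 1)) ≤ 2 := by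
    have := Real.log_le_sub_one_of_pos (show 0 < 1 + 2 / (x - 1) by linarith)
    calc (x - 1) * Real.log (1 + 2 / (x - 1)) ≤ (x - 1) * (2 / (x - 1)) := by
          gcongr
          linarith
      _ = 2 := by field_simp [show x - 1 ≠ 0 by linarith]
  have b4 : Real.log (1 + x) ≤ 2 * τ := by
    have h1 := Real.log_le_log (show 0 < 1 + x by linarith) (show 1 + x ≤ (1 + τ) ^ 2 by
      rw [hx]; nlinarith)
    rw [Real.log_pow] at h1
    have := Real.log_le_sub_one_of_pos (show 0 < 1 + τ by linarith)
    push_cast at h1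
    linarith
  have hnn : 0 ≤ logEntropy x := by
    rw [e]; have := mul_nonneg (show 0 ≤ x - 1 by linarith) b2; linarith
  have hle : logEntropy x ≤ 6 * τ := by rw [e]; linarith
  have h2 : logEntropy x / x ≤ 6 * τ⁻¹ := by
    rw [div_le_iff₀ (by linarith), hx]
    have : 6 * τ⁻¹ * τ ^ 2 = 6 * τ := by field_simp
    linarith
  have h3 : 0 ≤ logEntropy x / x := div_nonneg hnn (by linarith)
  have h4 : 0 < τ⁻¹ := inv_pos.2 (by linarith)
  rw [logPrimitive, norm_mul, ← hx, Real.norm_of_nonneg h3, Real.norm_of_nonpos (by norm_num)]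
  linarith

/-- The primitive vanishes at both ends and is continuous across `τ = 1`, so the two boundary terms
there cancel. -/
lemma integral_log_kernel_one :
    ∫ τ in Ioi (0 : ℝ), Real.log (1 - τ ^ 4) * τ ^ (-(1 + 2 * 1) : ℝ) = 0 := by
  have hint := integrableOn_log_kernel (s := 1) (by norm_num) le_rfl
  rw [← Ioc_union_Ioi_eq_Ioi zero_le_one] at hint ⊢
  have i1 := hint.mono_set subset_union_left
  have i2 := hint.mono_set subset_union_right
  rw [setIntegral_union Ioc_disjoint_Ioi_same measurableSet_Ioi i1 i2,
    ← intervalIntegral.integral_of_le zero_le_one,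
    intervalIntegral.integral_eq_sub_of_hasDerivAt_of_tendsto zero_lt_one
      (fun τ hτ => hasDerivAt_logPrimitive hτ.1 hτ.2.ne)
      ((intervalIntegrable_iff_integrableOn_Ioc_of_le zero_le_one).2 i1)
      tendsto_logPrimitive_zero
      ((continuousAt_logPrimitive one_pos).tendsto.mono_left nhdsWithin_le_nhds),
    integral_Ioi_of_hasDerivAt_of_tendsto
      (continuousAt_logPrimitive one_pos).continuousWithinAt
      (fun τ hτ => hasDerivAt_logPrimitive (one_pos.trans hτ) (ne_of_gt hτ)) i2
      tendsto_logPrimitive_atTop]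
  ring

/-- Passing from `s = 1` to `s < 1` multiplies the integrand by the increasing weight `τ^{2-2s}`.
Subtracting `T^{2-2s}` times the vanishing integral at `s = 1`, where `T = 2^{1/4}` is the sign
change of the logarithm, leaves a nonnegative integrand. -/
lemma integral_log_kernel_pos {s : ℝ} (hs : 1 / 2 < s) (hs1 : s < 1) :
    0 < ∫ τ in Ioi (0 : ℝ), Real.log (1 - τ ^ 4) * τ ^ (-(1 + 2 * s)) := by
  set T : ℝ := 2 ^ (1 / 4 : ℝ) with hT
  have hT0 : 0 < T := Real.rpow_pos_of_pos two_pos _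
  have hT4 : T ^ 4 = 2 := by
    rw [hT, ← Real.rpow_natCast, ← Real.rpow_mul two_pos.le]; norm_num
  have i1 := integrableOn_log_kernel hs hs1.le
  have i2 := (integrableOn_log_kernel (s := 1) (by norm_num) le_rfl).const_mul (T ^ (2 - 2 * s))
  have key : ∀ τ : ℝ, 0 < τ → Real.log (1 - τ ^ 4) * τ ^ (-(1 + 2 * s)) -
      T ^ (2 - 2 * s) * (Real.log (1 - τ ^ 4) * τ ^ (-(1 + 2 * 1) : ℝ)) =
      Real.log (1 - τ ^ 4) * (τ ^ (2 - 2 * s) - T ^ (2 - 2 * s)) * τ ^ (-(1 + 2 * 1) : ℝ) := by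
    intro τ hτ
    rw [show -(1 + 2 * s) = (2 - 2 * s) + -(1 + 2 * 1) by ring, Real.rpow_add hτ]
    ring
  have hpos : ∀ τ : ℝ, T < τ →
      0 < Real.log (1 - τ ^ 4) * (τ ^ (2 - 2 * s) - T ^ (2 - 2 * s)) := by
    intro τ hτ
    have h4 : 2 < τ ^ 4 := by rw [← hT4]; gcongr
    rw [← Real.log_neg_eq_log]
    refine mul_pos (Real.log_pos (by linarith)) (sub_pos.2 ?_)
    exact Real.rpow_lt_rpow hT0.le hτ (by linarith)
  have hnn : ∀ τ : ℝ, 0 < τ →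
      0 ≤ Real.log (1 - τ ^ 4) * (τ ^ (2 - 2 * s) - T ^ (2 - 2 * s)) := by
    intro τ h0
    rcases lt_or_ge T τ with h | h
    · exact (hpos τ h).le
    · have h4 : τ ^ 4 ≤ 2 := by rw [← hT4]; gcongr
      have : 0 < τ ^ 4 := by positivity
      rw [← Real.log_abs]
      refine mul_nonneg_of_nonpos_of_nonpos
        (Real.log_nonpos (abs_nonneg _) (abs_le.2 ⟨by linarith, by linarith⟩)) (sub_nonpos.2 ?_)
      exact Real.rpow_le_rpow h0.le h (by linarith)
  have hsub : 0 < ∫ τ in Ioi (0 : ℝ), (Real.log (1 - τ ^ 4) * τ ^ (-(1 + 2 * s)) -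
      T ^ (2 - 2 * s) * (Real.log (1 - τ ^ 4) * τ ^ (-(1 + 2 * 1) : ℝ))) := by
    have i12 : IntegrableOn (fun τ : ℝ => Real.log (1 - τ ^ 4) * τ ^ (-(1 + 2 * s)) -
      T ^ (2 - 2 * s) * (Real.log (1 - τ ^ 4) * τ ^ (-(1 + 2 * 1) : ℝ))) (Ioi 0) := i1.sub i2
    rw [setIntegral_pos_iff_support_of_nonneg_ae _ i12]
    · refine lt_of_lt_of_le ?_ (measure_mono (s := Ioo T (T + 1)) ?_)
      · simp
      · intro τ hτ
        have h0 : 0 < τ := hT0.trans hτ.1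
        refine ⟨?_, h0⟩
        rw [Function.mem_support, key τ h0]
        exact (mul_pos (hpos τ hτ.1) (Real.rpow_pos_of_pos h0 _)).ne'
    · refine (ae_restrict_mem measurableSet_Ioi).mono fun τ hτ => ?_
      simp only [Pi.zero_apply]
      rw [key τ hτ]
      exact mul_nonneg (hnn τ hτ) (Real.rpow_nonneg (le_of_lt hτ) _)
  rwa [integral_sub i1 i2, integral_const_mul, integral_log_kernel_one, mul_zero, sub_zero] at hsub

end LogIntegral

end FracTrunc

namespace FracTrunc

/-! ### The zero of `c_k` -/

section CFun

variable {s : ℝ}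

lemma Cs_pos (hs : 0 < s) (hs1 : s < 1) : 0 < Cs s := by
  have h1 : 0 < Real.Gamma (s + 1 / 2) := Real.Gamma_pos_of_pos (by linarith)
  have h2 : 0 < Real.Gamma (1 - s) := Real.Gamma_pos_of_pos (by linarith)
  have h3 : 0 < Real.sqrt Real.pi := Real.sqrt_pos.2 Real.pi_pos
  unfold Cs
  positivity

/-- `∫₀^∞ (|1 + τ|^{-γ} + |1 - τ|^{-γ} - 2) τ^{-(1+2s)} dτ`. -/
noncomputable def hatInt (s γ : ℝ) : ℝ :=
  ∫ τ in Ioi (0 : ℝ), hatDiff γ τ * τ ^ (-(1 + 2 * s))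

/-- `∫₀^∞ ((1 + τ²)^{-γ/2} - 1) τ^{-(1+2s)} dτ`. -/
noncomputable def perpInt (s γ : ℝ) : ℝ :=
  ∫ τ in Ioi (0 : ℝ), perpDiff γ τ * τ ^ (-(1 + 2 * s))

lemma cFun_eq (k : ℕ) (s γ : ℝ) :
    cFun k s γ = Cs s * (hatInt s γ + 2 * ((k : ℝ) - 1) * perpInt s γ) := by
  simp only [cFun, cHat, cPerp, hatInt, perpInt, hatDiff, perpDiff]
  ring

lemma convexOn_rpow_neg_mul {x : ℝ} (hx : 0 ≤ x) {c : ℝ} (hc : 0 < c) :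
    ConvexOn ℝ (Ioo (0 : ℝ) 1) fun γ => x ^ (-(γ * c)) := by
  -- The case `x = 0` occurs at `τ = 1`; there the function is constantly `0` because the exponent
  -- never vanishes on `(0, 1)`.
  rcases hx.eq_or_lt with rfl | hx
  · refine (convexOn_const 0 (convex_Ioo _ _)).congr fun γ hγ => ?_
    rw [Real.zero_rpow]
    have := mul_pos hγ.1 hc
    linarith
  · have := (convexOn_rpow_left hx).comp_linearMap (LinearMap.mul ℝ ℝ (-c))
    refine ⟨convex_Ioo _ _, fun a _ b _ p q hp hq hpq => ?_⟩
    have := this.2 (mem_univ a) (mem_univ b) hp hq hpq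
    simpa [mul_comm] using this

lemma convexOn_setIntegral {F : ℝ → ℝ → ℝ} {S : Set ℝ} (hS : Convex ℝ S)
    (hint : ∀ γ ∈ S, IntegrableOn (F γ) (Ioi 0))
    (hconv : ∀ τ ∈ Ioi (0 : ℝ), ConvexOn ℝ S fun γ => F γ τ) :
    ConvexOn ℝ S fun γ => ∫ τ in Ioi (0 : ℝ), F γ τ := by
  refine ⟨hS, fun a ha b hb p q hp hq hpq => ?_⟩
  have h1 := (hint a ha).const_mul p
  have h2 := (hint b hb).const_mul q
  simp only [smul_eq_mul]
  rw [← integral_const_mul, ← integral_const_mul, ← integral_add h1 h2]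
  exact setIntegral_mono_on (hint _ (hS ha hb hp hq hpq)) (h1.add h2) measurableSet_Ioi
    fun τ hτ => (hconv τ hτ).2 ha hb hp hq hpq

lemma convexOn_hatInt (hs : 0 < s) (hs1 : s < 1) : ConvexOn ℝ (Ioo (0 : ℝ) 1) (hatInt s) := by
  refine convexOn_setIntegral (convex_Ioo _ _) (fun γ hγ => integrableOn_hatDiff hs hs1 hγ) ?_
  intro τ hτ
  have h := ((convexOn_rpow_neg_mul (abs_nonneg (1 + τ)) one_pos).add
    (convexOn_rpow_neg_mul (abs_nonneg (1 - τ)) one_pos)).add (convexOn_const (-2)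
      (convex_Ioo _ _))
  have h2 := h.smul (Real.rpow_nonneg (le_of_lt hτ) (-(1 + 2 * s)))
  refine h2.congr fun γ _ => ?_
  simp only [Pi.add_apply, smul_eq_mul, mul_one, hatDiff]
  ring

lemma convexOn_perpInt (hs : 0 < s) (hs1 : s < 1) : ConvexOn ℝ (Ioo (0 : ℝ) 1) (perpInt s) := by
  refine convexOn_setIntegral (convex_Ioo _ _) (fun γ hγ => integrableOn_perpDiff hs hs1 hγ) ?_
  intro τ hτ
  have h := (convexOn_rpow_neg_mul (show 0 ≤ 1 + τ ^ 2 by positivity)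
    (show (0 : ℝ) < 1 / 2 by norm_num)).add (convexOn_const (-1) (convex_Ioo _ _))
  have h2 := h.smul (Real.rpow_nonneg (le_of_lt hτ) (-(1 + 2 * s)))
  refine h2.congr fun γ _ => ?_
  simp only [Pi.add_apply, smul_eq_mul, perpDiff]
  rw [show -(γ * (1 / 2)) = -γ / 2 by ring]
  ring

lemma perpInt_nonpos {γ : ℝ} (hγ : 0 ≤ γ) : perpInt s γ ≤ 0 :=
  setIntegral_nonpos measurableSet_Ioi fun τ hτ =>
    mul_nonpos_of_nonpos_of_nonneg (perpDiff_nonpos hγ τ) (Real.rpow_nonneg (le_of_lt hτ) _)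

lemma two_mul_perpInt_le_hatInt (hs : 0 < s) (hs1 : s < 1) {γ : ℝ} (hγ : γ ∈ Ioo (0 : ℝ) 1) :
    2 * perpInt s γ ≤ hatInt s γ := by
  unfold perpInt hatInt
  rw [← integral_const_mul]
  refine integral_mono_ae ((integrableOn_perpDiff hs hs1 hγ).const_mul 2)
    (integrableOn_hatDiff hs hs1 hγ) ?_
  filter_upwards [ae_restrict_mem measurableSet_Ioi,
    ae_restrict_of_ae (Measure.ae_ne volume (1 : ℝ))] with τ hτ h1
  have hτ : 0 < τ := hτ
  rw [← mul_assoc]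
  exact mul_le_mul_of_nonneg_right (two_mul_perpDiff_le_hatDiff hγ.1 h1 (by linarith))
    (Real.rpow_nonneg hτ.le _)

/-- `∫₀^∞ min(τ², 1) τ^{-(1+2s)} dτ`. -/
noncomputable def minInt (s : ℝ) : ℝ := ∫ τ in Ioi (0 : ℝ), min (τ ^ 2) 1 * τ ^ (-(1 + 2 * s))

lemma minInt_nonneg : 0 ≤ minInt s :=
  setIntegral_nonneg measurableSet_Ioi fun τ hτ =>
    mul_nonneg (le_min (sq_nonneg τ) zero_le_one) (Real.rpow_nonneg (le_of_lt hτ) _)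

lemma neg_minInt_le_perpInt (hs : 0 < s) (hs1 : s < 1) {γ : ℝ} (hγ : γ ∈ Ioo (0 : ℝ) 1) :
    -minInt s ≤ perpInt s γ := by
  unfold minInt perpInt
  rw [← integral_neg]
  refine setIntegral_mono_on (integrableOn_min_kernel hs hs1).neg
    (integrableOn_perpDiff hs hs1 hγ) measurableSet_Ioi fun τ hτ => ?_
  rw [← neg_mul]
  exact mul_le_mul_of_nonneg_right (neg_min_le_perpDiff hγ τ) (Real.rpow_nonneg (le_of_lt hτ) _)

lemma integral_one_sub_rpow {γ : ℝ} (hγ : γ ∈ Ioo (0 : ℝ) 1) :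
    1 / 2 * (1 - γ)⁻¹ ≤ ∫ τ in Ioc (1 / 2 : ℝ) 1, (1 - τ) ^ (-γ) := by
  rw [← intervalIntegral.integral_of_le (by norm_num),
    intervalIntegral.integral_comp_sub_left (fun x : ℝ => x ^ (-γ)) 1,
    integral_rpow (Or.inl (by linarith [hγ.2])), sub_self, Real.zero_rpow (by linarith [hγ.2]),
    sub_zero, show -γ + 1 = 1 - γ by ring]
  have : 0 < 1 - γ := by linarith [hγ.2]
  rw [show (1 : ℝ) - 1 / 2 = 1 / 2 by norm_num, div_eq_mul_inv ((1 / 2 : ℝ) ^ (1 - γ))]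
  refine mul_le_mul_of_nonneg_right ?_ (inv_pos.2 this).le
  have h := Real.rpow_le_rpow_of_exponent_ge (show (0 : ℝ) < 1 / 2 by norm_num) (by norm_num)
    (show 1 - γ ≤ 1 by linarith [hγ.1])
  rwa [Real.rpow_one] at h

/-- The blow-up as `γ → 1` comes from `(1 - τ)^{-γ}` on `(1/2, 1]`. The factor `8` serves to absorb
the `-2` of `hatDiff` there, as `8τ² ≥ 2`. -/
lemma hatInt_lower_bound (hs : 0 < s) (hs1 : s < 1) {γ : ℝ} (hγ : γ ∈ Ioo (0 : ℝ) 1) :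
    1 / 2 * (1 - γ)⁻¹ - 8 * minInt s ≤ hatInt s γ := by
  have i0 : IntegrableOn (fun τ : ℝ => (1 - τ) ^ (-γ)) (Ioc (1 / 2) 1) := by
    have := ((intervalIntegral.intervalIntegrable_rpow' (a := 0) (b := 1 / 2)
      (show -1 < -γ by linarith [hγ.2])).comp_sub_left 1).symm
    rw [sub_zero, show (1 : ℝ) - 1 / 2 = 1 / 2 by norm_num] at this
    exact (intervalIntegrable_iff_integrableOn_Ioc_of_le (by norm_num)).1 this
  have i1 : IntegrableOn ((Ioc (1 / 2 : ℝ) 1).indicator fun τ : ℝ => (1 - τ) ^ (-γ)) (Ioi 0) :=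
    (i0.integrable_indicator measurableSet_Ioc).integrableOn
  have i2 := (integrableOn_min_kernel hs hs1).const_mul 8
  have e1 : ∫ τ in Ioi (0 : ℝ), (Ioc (1 / 2 : ℝ) 1).indicator (fun τ : ℝ => (1 - τ) ^ (-γ)) τ =
      ∫ τ in Ioc (1 / 2 : ℝ) 1, (1 - τ) ^ (-γ) := by
    rw [setIntegral_indicator measurableSet_Ioc, inter_eq_self_of_subset_right]
    intro τ hτ
    have : 1 / 2 < τ := hτ.1
    exact show 0 < τ by linarith
  have h := integral_one_sub_rpow hγ
  rw [← e1] at h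
  refine (sub_le_sub_right h _).trans ?_
  unfold minInt hatInt
  rw [← integral_const_mul, ← integral_sub i1 i2]
  refine integral_mono_ae (i1.sub i2) (integrableOn_hatDiff hs hs1 hγ) ?_
  filter_upwards [ae_restrict_mem measurableSet_Ioi,
    ae_restrict_of_ae (Measure.ae_ne volume (1 : ℝ))] with τ hτ h1
  have hτ : 0 < τ := hτ
  have hk : 0 < τ ^ (-(1 + 2 * s)) := Real.rpow_pos_of_pos hτ _
  by_cases hm : τ ∈ Ioc (1 / 2 : ℝ) 1
  · rw [indicator_of_mem hm]
    have hlt : 0 < 1 - τ := by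
      rcases hm.2.lt_or_eq with h | h
      · linarith
      · exact absurd h h1
    have hk1 : 1 ≤ τ ^ (-(1 + 2 * s)) :=
      Real.one_le_rpow_of_pos_of_le_one_of_nonpos hτ hm.2 (by linarith)
    have hx : 0 < (1 - τ) ^ (-γ) := Real.rpow_pos_of_pos hlt _
    have hy : 0 < |1 + τ| ^ (-γ) := Real.rpow_pos_of_pos (abs_pos.2 (by linarith)) _
    rw [min_eq_left (by nlinarith [hm.2]), hatDiff, abs_of_pos hlt]
    have h8 : 2 ≤ 8 * τ ^ 2 := by nlinarith [hm.1]
    nlinarith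
  · rw [indicator_of_notMem hm]
    have h2 := two_mul_perpDiff_le_hatDiff hγ.1 h1 (show τ ≠ -1 by linarith)
    have h3 := neg_min_le_perpDiff hγ τ
    have h4 : 0 ≤ min (τ ^ 2) 1 := le_min (sq_nonneg τ) zero_le_one
    have h5 : -(8 * min (τ ^ 2) 1) ≤ hatDiff γ τ := by linarith
    have := mul_le_mul_of_nonneg_right h5 hk.le
    linarith

lemma exists_cFun_pos (k : ℕ) (hk : 2 ≤ k) (hs : 0 < s) (hs1 : s < 1) :
    ∃ γ ∈ Ioo (0 : ℝ) 1, 0 < cFun k s γ := by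
  have hk' : (2 : ℝ) ≤ k := by exact_mod_cast hk
  set M := (8 + 2 * ((k : ℝ) - 1)) * minInt s with hM
  have hM0 : 0 ≤ M := mul_nonneg (by linarith) minInt_nonneg
  have h0 : 0 < 2 * M + 2 := by linarith
  have hinv : (2 * M + 2)⁻¹ ≤ 1 / 2 := by
    rw [show (1 / 2 : ℝ) = 2⁻¹ by norm_num]; exact inv_anti₀ two_pos (by linarith)
  have hinv0 : 0 < (2 * M + 2)⁻¹ := inv_pos.2 h0
  -- This choice makes `(1 - γ)⁻¹ / 2 = M + 1`, just above the total negative contribution `M`.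
  have hγ : 1 - (2 * M + 2)⁻¹ ∈ Ioo (0 : ℝ) 1 := ⟨by linarith, by linarith⟩
  refine ⟨_, hγ, ?_⟩
  rw [cFun_eq]
  refine mul_pos (Cs_pos hs hs1) ?_
  have h1 := hatInt_lower_bound hs hs1 hγ
  have h2 := mul_le_mul_of_nonneg_left (neg_minInt_le_perpInt hs hs1 hγ)
    (show 0 ≤ 2 * ((k : ℝ) - 1) by linarith)
  rw [sub_sub_cancel, inv_inv] at h1
  have : M = 8 * minInt s + 2 * ((k : ℝ) - 1) * minInt s := by rw [hM]; ring
  linarith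

/-- By convexity of `γ ↦ x^{-γ}`, its difference quotient at `0` lies between the derivative at `0`
and the quotient at `1/2`. Both are independent of `γ` and give the dominating function for the
limit `γ → 0`. -/
lemma rpow_neg_sub_one_div_bounds {x γ : ℝ} (hx : 0 < x) (h0 : 0 < γ) (h1 : γ ≤ 1 / 2) :
    -Real.log x ≤ (x ^ (-γ) - 1) / γ ∧
      (x ^ (-γ) - 1) / γ ≤ (x ^ (-(1 / 2) : ℝ) - 1) / (1 / 2) := by
  constructor
  · rw [le_div_iff₀ h0, Real.rpow_def_of_pos hx]
    linarith [Real.add_one_le_exp (Real.log x * -γ)]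
  · have hy : 0 < x ^ (-(1 / 2) : ℝ) := Real.rpow_pos_of_pos hx _
    have := rpow_one_add_le_one_add_mul_self (s := x ^ (-(1 / 2) : ℝ) - 1) (p := 2 * γ)
      (by linarith) (by linarith) (by linarith)
    rw [add_sub_cancel, ← Real.rpow_mul hx.le, show -(1 / 2) * (2 * γ) = -γ by ring] at this
    rw [div_le_iff₀ h0]
    linarith

lemma tendsto_rpow_neg_sub_one_div {x : ℝ} (hx : 0 < x) :
    Tendsto (fun γ : ℝ => (x ^ (-γ) - 1) / γ) (𝓝[>] 0) (𝓝 (-Real.log x)) := by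
  have h : HasDerivAt (fun γ : ℝ => x ^ (-γ)) (-Real.log x) 0 := by
    have := (hasDerivAt_neg (0 : ℝ)).const_rpow hx
    simpa using this
  refine h.tendsto_slope_zero_right.congr fun γ => ?_
  simp only [zero_add, neg_zero, Real.rpow_zero, smul_eq_mul]
  ring

lemma hatDiff_add_perpDiff_eq (γ τ : ℝ) :
    hatDiff γ τ + 2 * perpDiff γ τ = (|1 + τ| ^ (-γ) - 1) + (|1 - τ| ^ (-γ) - 1) +
      2 * (Real.sqrt (1 + τ ^ 2) ^ (-γ) - 1) := by
  have : Real.sqrt (1 + τ ^ 2) ^ (-γ) = (1 + τ ^ 2) ^ (-γ / 2) := by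
    rw [Real.sqrt_eq_rpow, ← Real.rpow_mul (by positivity)]; congr 1; ring
  rw [this, hatDiff, perpDiff]
  ring

lemma log_one_sub_pow_four {τ : ℝ} (h0 : 0 < τ) (h1 : τ ≠ 1) :
    Real.log (1 - τ ^ 4) =
      Real.log |1 + τ| + Real.log |1 - τ| + 2 * Real.log (Real.sqrt (1 + τ ^ 2)) := by
  have hm : 1 - τ ≠ 0 := fun h => h1 (by linarith)
  rw [Real.log_sqrt (by positivity), Real.log_abs, Real.log_abs,
    show 1 - τ ^ 4 = (1 + τ) * (1 - τ) * (1 + τ ^ 2) by ring,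
    Real.log_mul (mul_ne_zero (by linarith) hm) (by positivity), Real.log_mul (by linarith) hm]
  ring

lemma tendsto_hatInt_add_perpInt_div (hs : 1 / 2 < s) (hs1 : s < 1) :
    Tendsto (fun γ : ℝ => ∫ τ in Ioi (0 : ℝ),
        (hatDiff γ τ + 2 * perpDiff γ τ) / γ * τ ^ (-(1 + 2 * s))) (𝓝[>] 0)
      (𝓝 (∫ τ in Ioi (0 : ℝ), -Real.log (1 - τ ^ 4) * τ ^ (-(1 + 2 * s)))) := by
  have hs0 : 0 < s := by linarith
  have hhalf : (1 / 2 : ℝ) ∈ Ioo (0 : ℝ) 1 := by constructor <;> norm_num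
  have i1 := (integrableOn_log_kernel hs hs1.le).norm
  have i2 := ((integrableOn_hatDiff hs0 hs1 hhalf).add
    ((integrableOn_perpDiff hs0 hs1 hhalf).const_mul 2)).norm.const_mul 2
  refine tendsto_integral_filter_of_dominated_convergence _ ?_ ?_ (i1.add i2) ?_
  · refine Eventually.of_forall fun γ => Measurable.aestronglyMeasurable ?_
    have := measurable_hatDiff γ
    have := measurable_perpDiff γ
    fun_prop
  · filter_upwards [Ioc_mem_nhdsGT (show (0 : ℝ) < 1 / 2 by norm_num)] with γ hγ
    filter_upwards [ae_restrict_mem measurableSet_Ioi,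
      ae_restrict_of_ae (Measure.ae_ne volume (1 : ℝ))] with τ hτ h1
    have hτ : 0 < τ := hτ
    have hk : 0 < τ ^ (-(1 + 2 * s)) := Real.rpow_pos_of_pos hτ _
    have b1 := rpow_neg_sub_one_div_bounds (abs_pos.2 (show 1 + τ ≠ 0 by linarith)) hγ.1 hγ.2
    have b2 := rpow_neg_sub_one_div_bounds
      (abs_pos.2 (show 1 - τ ≠ 0 from fun h => h1 (by linarith))) hγ.1 hγ.2
    have b3 := rpow_neg_sub_one_div_bounds
      (show 0 < Real.sqrt (1 + τ ^ 2) by positivity) hγ.1 hγ.2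
    have e : (hatDiff γ τ + 2 * perpDiff γ τ) / γ = (|1 + τ| ^ (-γ) - 1) / γ +
        (|1 - τ| ^ (-γ) - 1) / γ + 2 * ((Real.sqrt (1 + τ ^ 2) ^ (-γ) - 1) / γ) := by
      rw [hatDiff_add_perpDiff_eq]; ring
    have e2 := hatDiff_add_perpDiff_eq (1 / 2) τ
    have e3 := log_one_sub_pow_four hτ h1
    set X := hatDiff (1 / 2) τ + 2 * perpDiff (1 / 2) τ with hX
    have hle : |(hatDiff γ τ + 2 * perpDiff γ τ) / γ| ≤ |Real.log (1 - τ ^ 4)| + 2 * |X| := by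
      rw [e, abs_le]
      have c1 := neg_abs_le (Real.log (1 - τ ^ 4))
      have c2 := le_abs_self (Real.log (1 - τ ^ 4))
      have c3 := le_abs_self X
      have c4 := abs_nonneg X
      have c5 := abs_nonneg (Real.log (1 - τ ^ 4))
      constructor <;> linarith [b1.1, b1.2, b2.1, b2.2, b3.1, b3.2]
    simp only [Pi.add_apply]
    rw [norm_mul, norm_mul, Real.norm_of_nonneg hk.le, Real.norm_eq_abs, Real.norm_eq_abs]
    have e4 : ‖hatDiff (1 / 2) τ * τ ^ (-(1 + 2 * s)) +
        2 * (perpDiff (1 / 2) τ * τ ^ (-(1 + 2 * s)))‖ = |X| * τ ^ (-(1 + 2 * s)) := by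
      rw [← Real.norm_of_nonneg hk.le, ← Real.norm_eq_abs X, ← norm_mul, hX,
        Real.norm_of_nonneg hk.le]
      congr 1; ring
    rw [e4]
    calc _ ≤ (|Real.log (1 - τ ^ 4)| + 2 * |X|) * τ ^ (-(1 + 2 * s)) := by gcongr
      _ = _ := by ring
  · filter_upwards [ae_restrict_mem measurableSet_Ioi,
      ae_restrict_of_ae (Measure.ae_ne volume (1 : ℝ))] with τ hτ h1
    have hτ : 0 < τ := hτ
    have b1 := tendsto_rpow_neg_sub_one_div (abs_pos.2 (show 1 + τ ≠ 0 by linarith))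
    have b2 := tendsto_rpow_neg_sub_one_div
      (abs_pos.2 (show 1 - τ ≠ 0 from fun h => h1 (by linarith)))
    have b3 := tendsto_rpow_neg_sub_one_div (show 0 < Real.sqrt (1 + τ ^ 2) by positivity)
    have b := ((b1.add b2).add (b3.const_mul 2)).mul_const (τ ^ (-(1 + 2 * s)))
    rw [log_one_sub_pow_four hτ h1]
    convert! b using 2
    · rw [hatDiff_add_perpDiff_eq]; ring
    · ring

/-- The derivative at `0` settles `k = 2`; for larger `k` the additional multiples of `perpInt` are
nonpositive. -/
lemma eventually_cFun_neg (k : ℕ) (hk : 2 ≤ k) (hs : 1 / 2 < s) (hs1 : s < 1) :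
    ∀ᶠ γ in 𝓝[>] (0 : ℝ), cFun k s γ < 0 := by
  have hs0 : 0 < s := by linarith
  have hk' : (2 : ℝ) ≤ k := by exact_mod_cast hk
  have hneg : ∫ τ in Ioi (0 : ℝ), -Real.log (1 - τ ^ 4) * τ ^ (-(1 + 2 * s)) < 0 := by
    simp only [neg_mul]
    rw [integral_neg]
    linarith [integral_log_kernel_pos hs hs1]
  filter_upwards [(tendsto_hatInt_add_perpInt_div hs hs1).eventually_lt_const hneg,
    Ioo_mem_nhdsGT (zero_lt_one (α := ℝ))] with γ h hγ
  have e : ∫ τ in Ioi (0 : ℝ), (hatDiff γ τ + 2 * perpDiff γ τ) / γ * τ ^ (-(1 + 2 * s)) =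
      (hatInt s γ + 2 * perpInt s γ) / γ := by
    unfold hatInt perpInt
    rw [← integral_const_mul, ← integral_add (integrableOn_hatDiff hs0 hs1 hγ)
      ((integrableOn_perpDiff hs0 hs1 hγ).const_mul 2), ← integral_div]
    congr 1; ext τ; ring
  rw [e, div_lt_iff₀ hγ.1, zero_mul] at h
  rw [cFun_eq]
  refine mul_neg_of_pos_of_neg (Cs_pos hs0 hs1) ?_
  nlinarith [perpInt_nonpos (s := s) hγ.1.le]

lemma convexOn_cFun (k : ℕ) (hk : 2 ≤ k) (hs : 0 < s) (hs1 : s < 1) :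
    ConvexOn ℝ (Ioo (0 : ℝ) 1) (cFun k s) := by
  have hk' : (2 : ℝ) ≤ k := by exact_mod_cast hk
  refine (((convexOn_hatInt hs hs1).add ((convexOn_perpInt hs hs1).smul
    (show 0 ≤ 2 * ((k : ℝ) - 1) by linarith))).smul (Cs_pos hs hs1).le).congr fun γ _ => ?_
  simp [cFun_eq]

/-- The function `c_k` has a unique zero in `(0, 1)`, at which it changes sign. -/
lemma exists_cFun_zero (k : ℕ) (hk : 2 ≤ k) (hs : 1 / 2 < s) (hs1 : s < 1) :
    ∃ γb ∈ Ioo (0 : ℝ) 1, cFun k s γb = 0 ∧ (∀ γ ∈ Ioo 0 γb, cFun k s γ < 0) ∧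
      ∀ γ ∈ Ioo γb 1, 0 < cFun k s γ := by
  have hs0 : 0 < s := by linarith
  have hconv := convexOn_cFun k hk hs0 hs1
  have hneg : ∀ a : ℝ, 0 < a → ∃ γ ∈ Ioo 0 a, cFun k s γ < 0 := fun a ha =>
    (((eventually_cFun_neg k hk hs hs1).and (Ioo_mem_nhdsGT ha)).exists).imp fun γ h => ⟨h.2, h.1⟩
  obtain ⟨γ₁, hγ₁, hpos⟩ := exists_cFun_pos k hk hs0 hs1
  obtain ⟨γ₀, hγ₀, hlt⟩ := hneg γ₁ hγ₁.1
  have hcont : ContinuousOn (cFun k s) (Icc γ₀ γ₁) :=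
    (hconv.continuousOn isOpen_Ioo).mono fun x hx => ⟨hγ₀.1.trans_le hx.1, hx.2.trans_lt hγ₁.2⟩
  obtain ⟨γb, hγb, hz⟩ := intermediate_value_Icc hγ₀.2.le hcont ⟨hlt.le, hpos.le⟩
  have hγb' : γb ∈ Ioo (0 : ℝ) 1 := ⟨hγ₀.1.trans_le hγb.1, hγb.2.trans_lt hγ₁.2⟩
  -- Convexity: a negative value on the left and a nonpositive one on the right force negativity
  -- strictly between them.
  have hchord : ∀ a b c : ℝ, a ∈ Ioo (0 : ℝ) 1 → c ∈ Ioo (0 : ℝ) 1 → a < b → b < c →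
      cFun k s a < 0 → cFun k s c ≤ 0 → cFun k s b < 0 := by
    intro a b c ha hc hab hbc h1 h2
    have p1 : 0 < (c - b) / (c - a) := div_pos (by linarith) (by linarith)
    have p2 : 0 < (b - a) / (c - a) := div_pos (by linarith) (by linarith)
    have := hconv.2 ha hc p1.le p2.le
      (by rw [← add_div, div_eq_one_iff_eq (by linarith)]; ring)
    have hca : c - a ≠ 0 := by linarith
    rw [show ((c - b) / (c - a)) • a + ((b - a) / (c - a)) • c = b by
      simp only [smul_eq_mul]; field_simp; ring] at this
    simp only [smul_eq_mul] at this
    nlinarith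
  refine ⟨γb, hγb', hz, fun γ hγ => ?_, fun γ hγ => ?_⟩
  · obtain ⟨a, ha, h⟩ := hneg γ hγ.1
    exact hchord a γ γb ⟨ha.1, ha.2.trans (hγ.2.trans hγb'.2)⟩ hγb' ha.2 hγ.2 h hz.le
  · by_contra! hc
    obtain ⟨a, ha, h⟩ := hneg γb hγb'.1
    exact (hchord a γb γ ⟨ha.1, ha.2.trans hγb'.2⟩ ⟨hγb'.1.trans hγ.1, hγ.2⟩ ha.2 hγ.1 h hc).ne hz

end CFun

end FracTrunc

namespace FracTrunc

/-! ### Bounds for the directional operators -/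

section Operators

variable {N : ℕ}

lemma eint_mono_ae {A : Set ℝ} {f g : ℝ → ℝ}
    (h : ∀ᵐ τ ∂volume.restrict A, f τ ≤ g τ) : eint A f ≤ eint A g := by
  unfold eint
  refine EReal.sub_le_sub ?_ ?_
  · exact EReal.coe_ennreal_le_coe_ennreal_iff.2
      (lintegral_mono_ae (h.mono fun τ hτ => ENNReal.ofReal_le_ofReal hτ))
  · exact EReal.coe_ennreal_le_coe_ennreal_iff.2
      (lintegral_mono_ae (h.mono fun τ hτ => ENNReal.ofReal_le_ofReal (neg_le_neg hτ)))

lemma eint_eq_integral {A : Set ℝ} {f : ℝ → ℝ} (h : IntegrableOn f A) :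
    eint A f = ((∫ τ in A, f τ : ℝ) : EReal) := by
  rw [eint, integral_eq_lintegral_pos_part_sub_lintegral_neg_part h]
  have h1 : ∫⁻ τ in A, ENNReal.ofReal (f τ) ≠ ⊤ := h.lintegral_lt_top.ne
  have h2 : ∫⁻ τ in A, ENNReal.ofReal (-f τ) ≠ ⊤ := h.neg.lintegral_lt_top.ne
  rw [EReal.coe_sub, EReal.coe_ennreal_toReal h1, EReal.coe_ennreal_toReal h2]

lemma setOf_le_abs_eq (δ : ℝ) : {τ : ℝ | δ ≤ |τ|} = Iic (-δ) ∪ Ici δ := by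
  ext τ
  simp only [mem_ofPred_eq, mem_union, mem_Iic, mem_Ici, le_abs, le_neg]
  tauto

lemma integrableOn_le_abs {G : ℝ → ℝ} {δ : ℝ} (h1 : IntegrableOn G (Ioi δ))
    (h2 : IntegrableOn (fun τ => G (-τ)) (Ioi δ)) : IntegrableOn G {τ | δ ≤ |τ|} := by
  rw [setOf_le_abs_eq]
  refine IntegrableOn.union ?_ ((integrableOn_Ici_iff_integrableOn_Ioi (by simp)).2 h1)
  rw [integrableOn_Iic_iff_integrableOn_Iio (by simp)]
  have := h2.comp_neg
  simpa using this

lemma integral_le_abs {G : ℝ → ℝ} {δ : ℝ} (hδ : 0 < δ) (h1 : IntegrableOn G (Ioi δ))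
    (h2 : IntegrableOn (fun τ => G (-τ)) (Ioi δ)) :
    ∫ τ in {τ | δ ≤ |τ|}, G τ = ∫ τ in Ioi δ, (G τ + G (-τ)) := by
  have h := integrableOn_le_abs h1 h2
  rw [setOf_le_abs_eq] at h ⊢
  rw [setIntegral_union _ measurableSet_Ici (h.mono_set subset_union_left)
    (h.mono_set subset_union_right), integral_Ici_eq_integral_Ioi, integral_add h1 h2,
    integral_comp_neg_Ioi, add_comm]
  rw [Set.disjoint_left]
  intro τ h3 h4
  have : τ ≤ -δ := h3
  have : δ ≤ τ := h4
  linarith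

lemma integral_Ioi_eq_add {F : ℝ → ℝ} {δ : ℝ} (hδ : 0 < δ) (h : IntegrableOn F (Ioi 0)) :
    ∫ τ in Ioi (0 : ℝ), F τ = (∫ τ in Ioo 0 δ, F τ) + ∫ τ in Ioi δ, F τ := by
  rw [← Ioc_union_Ioi_eq_Ioi hδ.le] at h ⊢
  rw [setIntegral_union Ioc_disjoint_Ioi_same measurableSet_Ioi (h.mono_set subset_union_left)
    (h.mono_set subset_union_right), integral_Ioc_eq_integral_Ioo]

variable {s : ℝ} {u φ : EuclideanSpace ℝ (Fin N) → ℝ} {x ξ : EuclideanSpace ℝ (Fin N)} {δ : ℝ}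

/-- The inner part is symmetrized and the outer part is not, so two minorants are needed: `D` for
the second difference, `W` for the one-sided increment. Their compatibility beyond `δ` merges
everything into one integral on `(0, ∞)`. No integrability of `u` is required, as the outer part may
be `+∞`. -/
lemma le_innerPart_add_outerPart (hs : 0 < s) (hs1 : s < 1) (hδ : 0 < δ) {D W : ℝ → ℝ}
    (hD : IntegrableOn (fun τ => D τ * τ ^ (-(1 + 2 * s))) (Ioi 0))
    (hW1 : IntegrableOn (fun τ => W τ * τ ^ (-(1 + 2 * s))) (Ioi δ))
    (hW2 : IntegrableOn (fun τ => W (-τ) * τ ^ (-(1 + 2 * s))) (Ioi δ))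
    (hDW : ∀ τ, δ < τ → D τ = W τ + W (-τ))
    (hin : ∀ τ ∈ Ioo 0 δ, D τ ≤ φ (x + τ • ξ) + φ (x - τ • ξ) - 2 * φ x)
    (hout : ∀ τ, δ ≤ |τ| → W τ ≤ u (x + τ • ξ) - u x) :
    ((Cs s * ∫ τ in Ioi (0 : ℝ), D τ * τ ^ (-(1 + 2 * s)) : ℝ) : EReal) ≤
      innerPart s φ x δ ξ + outerPart s u x δ ξ := by
  have hC := Cs_pos hs hs1
  have e1 : ∀ τ ∈ Ioi δ, W τ * τ ^ (-(1 + 2 * s)) = W τ * |τ| ^ (-(1 + 2 * s)) := fun τ hτ => by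
    rw [abs_of_pos (hδ.trans hτ)]
  have e2 : ∀ τ ∈ Ioi δ, W (-τ) * τ ^ (-(1 + 2 * s)) = W (-τ) * |-τ| ^ (-(1 + 2 * s)) :=
    fun τ hτ => by rw [abs_neg, abs_of_pos (hδ.trans hτ)]
  have g1 : IntegrableOn (fun τ => W τ * |τ| ^ (-(1 + 2 * s))) (Ioi δ) :=
    hW1.congr_fun e1 measurableSet_Ioi
  have g2 : IntegrableOn (fun τ => W (-τ) * |-τ| ^ (-(1 + 2 * s))) (Ioi δ) :=
    hW2.congr_fun e2 measurableSet_Ioi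
  have iout := (integrableOn_le_abs g1 g2).const_mul (Cs s)
  have iin : IntegrableOn (fun τ => Cs s * (D τ * τ ^ (-(1 + 2 * s)))) (Ioo 0 δ) :=
    (hD.mono_set Ioo_subset_Ioi_self).const_mul (Cs s)
  have hA : MeasurableSet {τ : ℝ | δ ≤ |τ|} := measurableSet_le measurable_const measurable_norm
  have hsplit : ∫ τ in Ioi δ, D τ * τ ^ (-(1 + 2 * s)) =
      ∫ τ in {τ | δ ≤ |τ|}, W τ * |τ| ^ (-(1 + 2 * s)) := by
    rw [integral_le_abs hδ g1 g2]
    refine setIntegral_congr_fun measurableSet_Ioi fun τ hτ => ?_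
    rw [← e1 τ hτ, ← e2 τ hτ, hDW τ hτ]
    ring
  rw [integral_Ioi_eq_add hδ hD, hsplit, mul_add, EReal.coe_add, ← integral_const_mul,
    ← integral_const_mul, ← eint_eq_integral iin, ← eint_eq_integral iout]
  refine add_le_add (eint_mono_ae ?_) (eint_mono_ae ?_)
  · refine (ae_restrict_mem measurableSet_Ioo).mono fun τ hτ => ?_
    have := Real.rpow_nonneg hτ.1.le (-(1 + 2 * s))
    have := hin τ hτ
    gcongr
  · refine (ae_restrict_mem hA).mono fun τ hτ => ?_
    have := Real.rpow_nonneg (abs_nonneg τ) (-(1 + 2 * s))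
    have := hout τ hτ
    gcongr

/-- The majorants are needed only almost everywhere: the radial increment used later takes the value
`0 ^ (-γ) = 0` at its singular point, where the pointwise inequality may fail. -/
lemma innerPart_add_outerPart_le (hs : 0 < s) (hs1 : s < 1) (hδ : 0 < δ) {D : ℝ → ℝ}
    (hD : IntegrableOn (fun τ => D τ * τ ^ (-(1 + 2 * s))) (Ioi 0))
    (hu1 : IntegrableOn (fun τ => (u (x + τ • ξ) - u x) * τ ^ (-(1 + 2 * s))) (Ioi δ))
    (hu2 : IntegrableOn (fun τ => (u (x - τ • ξ) - u x) * τ ^ (-(1 + 2 * s))) (Ioi δ))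
    (hin : ∀ᵐ τ : ℝ, τ ∈ Ioo 0 δ → φ (x + τ • ξ) + φ (x - τ • ξ) - 2 * φ x ≤ D τ)
    (hout : ∀ᵐ τ : ℝ, δ < τ → u (x + τ • ξ) + u (x - τ • ξ) - 2 * u x ≤ D τ) :
    innerPart s φ x δ ξ + outerPart s u x δ ξ ≤
      ((Cs s * ∫ τ in Ioi (0 : ℝ), D τ * τ ^ (-(1 + 2 * s)) : ℝ) : EReal) := by
  have hC := Cs_pos hs hs1
  set W : ℝ → ℝ := fun τ => u (x + τ • ξ) - u x with hW
  have hWn : ∀ τ, W (-τ) = u (x - τ • ξ) - u x := fun τ => by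
    simp only [hW, neg_smul, sub_eq_add_neg]
  have e1 : ∀ τ ∈ Ioi δ, W τ * τ ^ (-(1 + 2 * s)) = W τ * |τ| ^ (-(1 + 2 * s)) := fun τ hτ => by
    rw [abs_of_pos (hδ.trans hτ)]
  have e2 : ∀ τ ∈ Ioi δ, (u (x - τ • ξ) - u x) * τ ^ (-(1 + 2 * s)) =
      W (-τ) * |-τ| ^ (-(1 + 2 * s)) :=
    fun τ hτ => by rw [abs_neg, abs_of_pos (hδ.trans hτ), hWn]
  have g1 : IntegrableOn (fun τ => W τ * |τ| ^ (-(1 + 2 * s))) (Ioi δ) :=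
    hu1.congr_fun e1 measurableSet_Ioi
  have g2 : IntegrableOn (fun τ => W (-τ) * |-τ| ^ (-(1 + 2 * s))) (Ioi δ) :=
    hu2.congr_fun e2 measurableSet_Ioi
  have iout := (integrableOn_le_abs g1 g2).const_mul (Cs s)
  have iin : IntegrableOn (fun τ => Cs s * (D τ * τ ^ (-(1 + 2 * s)))) (Ioo 0 δ) :=
    (hD.mono_set Ioo_subset_Ioi_self).const_mul (Cs s)
  rw [integral_Ioi_eq_add hδ hD, mul_add, EReal.coe_add]
  refine add_le_add ?_ ?_
  · rw [← integral_const_mul, ← eint_eq_integral iin]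
    refine eint_mono_ae ?_
    filter_upwards [ae_restrict_mem measurableSet_Ioo, ae_restrict_of_ae hin] with τ hτ h
    have := Real.rpow_nonneg hτ.1.le (-(1 + 2 * s))
    have := h hτ
    gcongr
  · have : outerPart s u x δ ξ =
        ((∫ τ in {τ | δ ≤ |τ|}, Cs s * (W τ * |τ| ^ (-(1 + 2 * s))) : ℝ) : EReal) :=
      eint_eq_integral iout
    rw [this, integral_const_mul, integral_le_abs hδ g1 g2]
    refine EReal.coe_le_coe_iff.2 (mul_le_mul_of_nonneg_left ?_ hC.le)
    refine integral_mono_ae (g1.add g2) (hD.mono_set (Ioi_subset_Ioi hδ.le)) ?_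
    filter_upwards [ae_restrict_mem measurableSet_Ioi, ae_restrict_of_ae hout] with τ hτ h
    have hτ0 : 0 < τ := hδ.trans hτ
    have h0 := Real.rpow_nonneg hτ0.le (-(1 + 2 * s))
    have h1 := mul_le_mul_of_nonneg_right (h hτ) h0
    rw [abs_neg, abs_of_pos hτ0, hWn]
    refine le_trans (le_of_eq ?_) h1
    simp only [hW]
    ring

end Operators

/-! ### Orthonormal frames and testing along a single frame -/

section Frames

variable {N k : ℕ}

lemma exists_orthonormal_frame (hkN : k ≤ N) (i₀ : Fin k) {e : EuclideanSpace ℝ (Fin N)}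
    (he : ‖e‖ = 1) : ∃ ξ : Fin k → EuclideanSpace ℝ (Fin N), Orthonormal ℝ ξ ∧ ξ i₀ = e := by
  have h := Orthonormal.exists_orthonormalBasis_extension_of_card_eq (𝕜 := ℝ)
    (E := EuclideanSpace ℝ (Fin N)) (ι := Fin N) (by simp) (v := fun _ => e)
    (s := {Fin.castLE hkN i₀}) ?_
  · obtain ⟨b, hb⟩ := h
    refine ⟨fun i => b (Fin.castLE hkN i), ?_, hb _ rfl⟩
    exact b.orthonormal.comp _ (Fin.castLE_injective hkN)
  · constructor
    · intro i; simpa using he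
    · intro i j hij; exact absurd (Subsingleton.elim i j) hij

lemma sum_ite_eq_add (i₀ : Fin k) (a b : ℝ) :
    ∑ i : Fin k, (if i = i₀ then a else b) = a + ((k : ℝ) - 1) * b := by
  have : ∀ i : Fin k, (if i = i₀ then a else b) = b + if i = i₀ then a - b else 0 := by
    intro i; split_ifs <;> ring
  simp only [this, Finset.sum_add_distrib, Finset.sum_const, Finset.card_univ, Fintype.card_fin,
    Finset.sum_ite_eq', Finset.mem_univ, if_true, nsmul_eq_mul]
  ring

lemma coe_finset_sum_le {ι : Type*} (S : Finset ι) {L : ι → ℝ} {M : ι → EReal}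
    (h : ∀ i ∈ S, (L i : EReal) ≤ M i) : ((∑ i ∈ S, L i : ℝ) : EReal) ≤ ∑ i ∈ S, M i := by
  have : ((∑ i ∈ S, L i : ℝ) : EReal) = ∑ i ∈ S, (L i : EReal) :=
    map_sum (⟨⟨Real.toEReal, EReal.coe_zero⟩, EReal.coe_add⟩ : ℝ →+ EReal) L S
  rw [this]
  exact Finset.sum_le_sum h

/-- As the operator is a supremum over frames, nonexistence arguments may choose one convenient
frame and bound each direction from below. -/
lemma IsViscositySupersolution.sum_add_le {s : ℝ} {f : ℝ → ℝ}
    {u φ : EuclideanSpace ℝ (Fin N) → ℝ} (hu : IsViscositySupersolution k s f u)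
    {x : EuclideanSpace ℝ (Fin N)} {δ : ℝ} (hδ : 0 < δ) (hφ : ContDiffOn ℝ 2 φ (Metric.ball x δ))
    (hmin : ∀ y ∈ Metric.ball x δ, u x - φ x ≤ u y - φ y)
    {ξ : Fin k → EuclideanSpace ℝ (Fin N)} (hξ : Orthonormal ℝ ξ) {L : Fin k → ℝ}
    (hL : ∀ i, (L i : EReal) ≤ innerPart s φ x δ (ξ i) + outerPart s u x δ (ξ i)) :
    ∑ i, L i + f (u x) ≤ 0 := by
  have h := hu.2 x δ φ hδ hφ hmin
  have h2 : ((∑ i, L i : ℝ) : EReal) ≤ maxOp k s u φ x δ :=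
    (coe_finset_sum_le _ fun i _ => hL i).trans
      (le_iSup (fun ξ : {ξ : Fin k → EuclideanSpace ℝ (Fin N) // Orthonormal ℝ ξ} =>
        ∑ i, (innerPart s φ x δ (ξ.1 i) + outerPart s u x δ (ξ.1 i))) ⟨ξ, hξ⟩)
  have h3 := (add_le_add_left h2 ((f (u x) : ℝ) : EReal)).trans h
  rw [← EReal.coe_add] at h3
  exact_mod_cast h3

end Frames

end FracTrunc

namespace FracTrunc

/-! ### Testing with radial powers -/

section Radial

lemma hatDiff_comp_div {γ r : ℝ} (hr : 0 < r) (τ : ℝ) :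
    |r + τ| ^ (-γ) + |r - τ| ^ (-γ) - 2 * r ^ (-γ) = r ^ (-γ) * hatDiff γ (τ / r) := by
  have h1 : |r + τ| = r * |1 + τ / r| := by
    rw [← abs_of_pos hr, ← abs_mul, abs_of_pos hr]; congr 1; field_simp
  have h2 : |r - τ| = r * |1 - τ / r| := by
    rw [← abs_of_pos hr, ← abs_mul, abs_of_pos hr]; congr 1; field_simp
  rw [h1, h2, Real.mul_rpow hr.le (abs_nonneg _), Real.mul_rpow hr.le (abs_nonneg _), hatDiff]
  ring

lemma perpDiff_comp_div {γ r : ℝ} (hr : 0 < r) (τ : ℝ) :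
    (r ^ 2 + τ ^ 2) ^ (-γ / 2) - r ^ (-γ) = r ^ (-γ) * perpDiff γ (τ / r) := by
  have h1 : r ^ 2 + τ ^ 2 = r ^ 2 * (1 + (τ / r) ^ 2) := by field_simp
  have h2 : (r ^ 2) ^ (-γ / 2) = r ^ (-γ) := by
    rw [← abs_rpow_neg_eq, abs_of_pos hr]
  rw [h1, Real.mul_rpow (by positivity) (by positivity), h2, perpDiff]
  ring

variable {N k : ℕ} {s : ℝ}

lemma norm_add_smul_self_dir {x : EuclideanSpace ℝ (Fin N)} (hx : x ≠ 0) (τ : ℝ) :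
    ‖x + τ • (‖x‖⁻¹ • x)‖ = |‖x‖ + τ| := by
  have h0 : ‖x‖ ≠ 0 := norm_ne_zero_iff.2 hx
  have : x + τ • (‖x‖⁻¹ • x) = (‖x‖⁻¹ * (‖x‖ + τ)) • x := by
    rw [smul_smul, mul_add, inv_mul_cancel₀ h0, add_smul, one_smul, mul_comm τ]
  rw [this, norm_smul, norm_mul, norm_inv, norm_norm, Real.norm_eq_abs]
  field_simp

lemma norm_sub_smul_self_dir {x : EuclideanSpace ℝ (Fin N)} (hx : x ≠ 0) (τ : ℝ) :
    ‖x - τ • (‖x‖⁻¹ • x)‖ = |‖x‖ - τ| := by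
  have := norm_add_smul_self_dir hx (-τ)
  rwa [neg_smul, ← sub_eq_add_neg, ← sub_eq_add_neg] at this

lemma norm_add_smul_orthogonal {x ξ : EuclideanSpace ℝ (Fin N)} (h : inner ℝ x ξ = 0)
    (hξ : ‖ξ‖ = 1) (τ : ℝ) : ‖x + τ • ξ‖ ^ 2 = ‖x‖ ^ 2 + τ ^ 2 := by
  rw [norm_add_sq_real, inner_smul_right, h, norm_smul, hξ, Real.norm_eq_abs, mul_one, sq_abs]
  ring

lemma norm_rpow_neg_add_smul_orthogonal {x ξ : EuclideanSpace ℝ (Fin N)} (h : inner ℝ x ξ = 0)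
    (hξ : ‖ξ‖ = 1) (γ τ : ℝ) :
    ‖x + τ • ξ‖ ^ (-γ) = (‖x‖ ^ 2 + τ ^ 2) ^ (-γ / 2) := by
  rw [← norm_add_smul_orthogonal h hξ, ← abs_rpow_neg_eq, abs_norm]

lemma contDiffOn_norm_rpow {γ δ : ℝ} {x : EuclideanSpace ℝ (Fin N)} (hδ : δ ≤ ‖x‖) :
    ContDiffOn ℝ 2 (fun y => ‖y‖ ^ (-γ)) (Metric.ball x δ) := by
  intro y hy
  have hy0 : y ≠ 0 := by
    rintro rfl
    rw [Metric.mem_ball, dist_zero_left] at hy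
    linarith
  exact (((contDiffAt_norm ℝ hy0).rpow_const_of_ne (norm_ne_zero_iff.2 hy0))).contDiffWithinAt

/-- The inequality obtained at a point where `a |·|^{-γ} + b |·|^{-γ'}`, set to zero in the ball
of radius `ε`, touches a supersolution from below. -/
theorem radial_test (hk : 1 ≤ k) (hkN : k ≤ N) (hs : 0 < s) (hs1 : s < 1) {f : ℝ → ℝ}
    {u : EuclideanSpace ℝ (Fin N) → ℝ} (hu : IsViscositySupersolution k s f u)
    {x : EuclideanSpace ℝ (Fin N)} {r ε a b γ γ' : ℝ} (hr : ‖x‖ = r) (hε : 0 ≤ ε) (hεr : ε < r)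
    (hγ : γ ∈ Ioo (0 : ℝ) 1) (hγ' : γ' ∈ Ioo (0 : ℝ) 1)
    (h1 : ∀ y, ε ≤ ‖y‖ → a * ‖y‖ ^ (-γ) + b * ‖y‖ ^ (-γ') - (a * r ^ (-γ) + b * r ^ (-γ')) ≤
      u y - u x)
    (h2 : ∀ y, ‖y‖ < ε → -(a * r ^ (-γ) + b * r ^ (-γ')) ≤ u y - u x) :
    a * (r ^ (-γ) * r ^ (-(2 * s)) * cFun k s γ) + b * (r ^ (-γ') * r ^ (-(2 * s)) * cFun k s γ') -
      Cs s * (∫ τ in Ioo (r - ε) (r + ε),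
        (a * |r - τ| ^ (-γ) + b * |r - τ| ^ (-γ')) * τ ^ (-(1 + 2 * s))) + f (u x) ≤ 0 := by
  have hr0 : 0 < r := hε.trans_lt hεr
  have hx : x ≠ 0 := norm_ne_zero_iff.1 (by rw [hr]; exact hr0.ne')
  set δ := (r - ε) / 2 with hδ_def
  have hδ : 0 < δ := by rw [hδ_def]; linarith
  have hδε : δ < r - ε := by rw [hδ_def]; linarith
  set H : ℝ → ℝ := fun t => a * t ^ (-γ) + b * t ^ (-γ') with hH
  set φ : EuclideanSpace ℝ (Fin N) → ℝ := fun y => a * ‖y‖ ^ (-γ) + b * ‖y‖ ^ (-γ') with hφ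
  have hφx : φ x = H r := by simp only [hφ, hH, hr]
  obtain ⟨ξ, hξ, hξ0⟩ := exists_orthonormal_frame hkN ⟨0, hk⟩ (e := ‖x‖⁻¹ • x)
    (by rw [norm_smul, norm_inv, norm_norm, inv_mul_cancel₀ (norm_ne_zero_iff.2 hx)])
  have hball : ∀ y ∈ Metric.ball x δ, ε ≤ ‖y‖ := by
    intro y hy
    have := norm_sub_norm_le x y
    rw [Metric.mem_ball, dist_comm, dist_eq_norm] at hy
    linarith
  have hφC : ContDiffOn ℝ 2 φ (Metric.ball x δ) :=
    (contDiffOn_const.mul (contDiffOn_norm_rpow (by linarith))).add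
      (contDiffOn_const.mul (contDiffOn_norm_rpow (by linarith)))
  have hmin : ∀ y ∈ Metric.ball x δ, u x - φ x ≤ u y - φ y := by
    intro y hy
    have := h1 y (hball y hy)
    rw [hφx]; simp only [hφ, hH]; linarith
  -- the radial direction
  set G : ℝ → ℝ := (Ioo (r - ε) (r + ε)).indicator fun τ => H |r - τ| with hG
  have hG0 : ∀ τ, τ ∉ Ioo (r - ε) (r + ε) → G τ = 0 := fun τ h => indicator_of_notMem h _
  have iH : ∀ c : ℝ, IntegrableOn (fun τ => H |c + τ| * τ ^ (-(1 + 2 * s))) (Ioi δ) := by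
    intro c
    refine IntegrableOn.congr_fun (((integrableOn_abs_rpow_mul_kernel hs hγ c hδ).const_mul a).add
      ((integrableOn_abs_rpow_mul_kernel hs hγ' c hδ).const_mul b)) (fun τ _ => ?_)
      measurableSet_Ioi
    simp only [Pi.add_apply, hH]; ring
  have iH' : IntegrableOn (fun τ => H |r - τ| * τ ^ (-(1 + 2 * s))) (Ioi δ) := by
    refine (iH (-r)).congr_fun (fun τ _ => ?_) measurableSet_Ioi
    beta_reduce
    rw [show -r + τ = -(r - τ) by ring, abs_neg]
  have hsub : Ioo (r - ε) (r + ε) ⊆ Ioi δ := fun τ hτ => hδε.trans hτ.1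
  have hGk : (fun τ => G τ * τ ^ (-(1 + 2 * s))) = (Ioo (r - ε) (r + ε)).indicator
      fun τ => H |r - τ| * τ ^ (-(1 + 2 * s)) := by
    ext τ
    by_cases hτ : τ ∈ Ioo (r - ε) (r + ε)
    · rw [hG, indicator_of_mem hτ, indicator_of_mem hτ]
    · rw [hG, indicator_of_notMem hτ, indicator_of_notMem hτ, zero_mul]
  have iG : Integrable (fun τ => G τ * τ ^ (-(1 + 2 * s))) := by
    rw [hGk]
    exact (iH'.mono_set hsub).integrable_indicator measurableSet_Ioo
  have eG : ∫ τ in Ioi (0 : ℝ), G τ * τ ^ (-(1 + 2 * s)) =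
      ∫ τ in Ioo (r - ε) (r + ε), H |r - τ| * τ ^ (-(1 + 2 * s)) := by
    rw [hGk, setIntegral_indicator measurableSet_Ioo, inter_eq_self_of_subset_right]
    exact hsub.trans (Ioi_subset_Ioi hδ.le)
  set D : ℝ → ℝ := fun τ => a * r ^ (-γ) * hatDiff γ (τ / r) + b * r ^ (-γ') * hatDiff γ' (τ / r)
    with hD
  have hDH : ∀ τ, D τ = H |r + τ| + H |r - τ| - 2 * H r := by
    intro τ
    simp only [hD, hH, mul_assoc, ← hatDiff_comp_div hr0]
    ring
  have iγ := integrableOn_comp_div_kernel hr0 (integrableOn_hatDiff hs hs1 hγ)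
  have iγ' := integrableOn_comp_div_kernel hr0 (integrableOn_hatDiff hs hs1 hγ')
  have iD : IntegrableOn (fun τ => D τ * τ ^ (-(1 + 2 * s))) (Ioi 0) := by
    refine IntegrableOn.congr_fun ((iγ.const_mul (a * r ^ (-γ))).add
      (iγ'.const_mul (b * r ^ (-γ')))) (fun τ _ => ?_) measurableSet_Ioi
    simp only [Pi.add_apply, hD]; ring
  have eD : ∫ τ in Ioi (0 : ℝ), D τ * τ ^ (-(1 + 2 * s)) =
      a * (r ^ (-γ) * r ^ (-(2 * s)) * hatInt s γ) +
      b * (r ^ (-γ') * r ^ (-(2 * s)) * hatInt s γ') := by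
    have : ∀ τ : ℝ, D τ * τ ^ (-(1 + 2 * s)) =
        a * r ^ (-γ) * (hatDiff γ (τ / r) * τ ^ (-(1 + 2 * s))) +
        b * r ^ (-γ') * (hatDiff γ' (τ / r) * τ ^ (-(1 + 2 * s))) := fun τ => by
      simp only [hD]; ring
    simp only [this]
    rw [integral_add (iγ.const_mul _) (iγ'.const_mul _), integral_const_mul, integral_const_mul,
      integral_comp_div_kernel _ hr0, integral_comp_div_kernel _ hr0, hatInt, hatInt]
    ring
  -- The line through `x` and the origin meets the truncated ball only for `-τ` in `(r - ε, r + ε)`;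
  -- `G` records the mass removed there.
  have L0 := le_innerPart_add_outerPart (N := N) (u := u) (φ := φ) (x := x) (ξ := ‖x‖⁻¹ • x)
    hs hs1 hδ (D := fun τ => D τ - G τ)
    (W := fun τ => H |r + τ| - G (-τ) - H r)
    (IntegrableOn.congr_fun (iD.sub iG.integrableOn) (fun τ _ => by simp only [Pi.sub_apply]; ring)
      measurableSet_Ioi)
    (by
      refine IntegrableOn.congr_fun ((iH r).sub ((integrableOn_kernel hs hδ).const_mul (H r)))
        (fun τ hτ => ?_) measurableSet_Ioi
      have hτ : δ < τ := hτ
      rw [hG0 (-τ) (fun h => by linarith [h.1])]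
      simp only [Pi.sub_apply]; ring)
    (by
      refine IntegrableOn.congr_fun ((iH'.sub iG.integrableOn).sub
        ((integrableOn_kernel hs hδ).const_mul (H r))) (fun τ hτ => ?_) measurableSet_Ioi
      simp only [Pi.sub_apply, neg_neg, ← sub_eq_add_neg]; ring)
    (by
      intro τ hτ
      rw [hG0 (-τ) (fun h => by linarith [h.1]), hDH, neg_neg, ← sub_eq_add_neg]
      ring)
    (by
      intro τ hτ
      rw [hG0 τ (fun h => by linarith [h.1, hτ.2]), hDH, hφx]
      have n1 := norm_add_smul_self_dir hx τ
      have n2 := norm_sub_smul_self_dir hx τ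
      rw [hr] at n1 n2
      simp only [hφ, n1, n2, hr, hH]
      linarith)
    (by
      intro τ hτ
      have hn := norm_add_smul_self_dir hx τ
      rw [hr] at hn
      by_cases hc : |r + τ| < ε
      · have := h2 (x + τ • (‖x‖⁻¹ • x)) (by rw [hr, hn]; exact hc)
        have hm := abs_lt.1 hc
        have : G (-τ) = H |r + τ| := by
          rw [hG, indicator_of_mem (show -τ ∈ Ioo (r - ε) (r + ε) from ⟨by linarith, by linarith⟩),
            sub_neg_eq_add]
        simp only [this]
        linarith
      · have := h1 (x + τ • (‖x‖⁻¹ • x)) (by rw [hr, hn]; exact not_lt.1 hc)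
        rw [hr, hn] at this
        have e : G (-τ) = 0 := hG0 _ fun h => hc (abs_lt.2 ⟨by linarith [h.2], by linarith [h.1]⟩)
        simp only [e, hH, hr]
        linarith)
  -- the orthogonal directions
  set P : ℝ → ℝ := fun τ => a * r ^ (-γ) * perpDiff γ (τ / r) + b * r ^ (-γ') * perpDiff γ' (τ / r)
    with hP
  have jγ := integrableOn_comp_div_kernel hr0 (integrableOn_perpDiff hs hs1 hγ)
  have jγ' := integrableOn_comp_div_kernel hr0 (integrableOn_perpDiff hs hs1 hγ')
  have iP : IntegrableOn (fun τ => P τ * τ ^ (-(1 + 2 * s))) (Ioi 0) := by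
    refine IntegrableOn.congr_fun ((jγ.const_mul (a * r ^ (-γ))).add
      (jγ'.const_mul (b * r ^ (-γ')))) (fun τ _ => ?_) measurableSet_Ioi
    simp only [Pi.add_apply, hP]; ring
  have eP : ∫ τ in Ioi (0 : ℝ), (P τ + P τ) * τ ^ (-(1 + 2 * s)) =
      2 * (a * (r ^ (-γ) * r ^ (-(2 * s)) * perpInt s γ) +
      b * (r ^ (-γ') * r ^ (-(2 * s)) * perpInt s γ')) := by
    have : ∀ τ : ℝ, (P τ + P τ) * τ ^ (-(1 + 2 * s)) =
        2 * (a * r ^ (-γ)) * (perpDiff γ (τ / r) * τ ^ (-(1 + 2 * s))) +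
        2 * (b * r ^ (-γ')) * (perpDiff γ' (τ / r) * τ ^ (-(1 + 2 * s))) := fun τ => by
      simp only [hP]; ring
    simp only [this]
    rw [integral_add (jγ.const_mul _) (jγ'.const_mul _), integral_const_mul, integral_const_mul,
      integral_comp_div_kernel _ hr0, integral_comp_div_kernel _ hr0, perpInt, perpInt]
    ring
  have hPn : ∀ τ, P (-τ) = P τ := fun τ => by simp only [hP, perpDiff, neg_div, neg_sq]
  have hperp : ∀ i, i ≠ (⟨0, hk⟩ : Fin k) → inner ℝ x (ξ i) = 0 := by
    intro i hi
    have : inner ℝ (ξ ⟨0, hk⟩) (ξ i) = 0 := hξ.2 (Ne.symm hi)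
    rw [hξ0, inner_smul_left] at this
    rcases mul_eq_zero.1 this with h | h
    · exact absurd h (by simpa using hx)
    · exact h
  have hPφ : ∀ i, i ≠ (⟨0, hk⟩ : Fin k) → ∀ τ : ℝ, φ (x + τ • ξ i) - φ x = P τ := by
    intro i hi τ
    simp only [hφ, norm_rpow_neg_add_smul_orthogonal (hperp i hi) (hξ.1 i), hP, mul_assoc, hr,
      ← perpDiff_comp_div hr0]
    ring
  have L1 : ∀ i, i ≠ (⟨0, hk⟩ : Fin k) →
      ((Cs s * ∫ τ in Ioi (0 : ℝ), (P τ + P τ) * τ ^ (-(1 + 2 * s)) : ℝ) : EReal) ≤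
      innerPart s φ x δ (ξ i) + outerPart s u x δ (ξ i) := by
    intro i hi
    refine le_innerPart_add_outerPart hs hs1 hδ (W := P) ?_ (iP.mono_set (Ioi_subset_Ioi hδ.le))
      ?_ ?_ ?_ ?_
    · refine IntegrableOn.congr_fun (iP.add iP) (fun τ _ => ?_) measurableSet_Ioi
      simp only [Pi.add_apply]; ring
    · simp only [hPn]
      exact iP.mono_set (Ioi_subset_Ioi hδ.le)
    · intro τ _; rw [hPn]
    · intro τ _
      have e1 := hPφ i hi τ
      have e2 := hPφ i hi (-τ)
      rw [hPn, neg_smul, ← sub_eq_add_neg] at e2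
      linarith
    · intro τ _
      rw [← hPφ i hi τ, hφx]
      refine h1 _ ?_
      have := norm_add_smul_orthogonal (hperp i hi) (hξ.1 i) τ
      rw [hr] at this
      -- Orthogonal lines stay at distance at least `r > ε` from the origin, so truncation costs
      -- nothing along them.
      refine hεr.le.trans (le_of_sq_le_sq ?_ (norm_nonneg _))
      rw [this]; nlinarith [sq_nonneg τ]
  have hsum := hu.sum_add_le hδ hφC hmin hξ
    (L := fun i => if i = (⟨0, hk⟩ : Fin k) then
        Cs s * ∫ τ in Ioi (0 : ℝ), (D τ - G τ) * τ ^ (-(1 + 2 * s))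
      else Cs s * ∫ τ in Ioi (0 : ℝ), (P τ + P τ) * τ ^ (-(1 + 2 * s)))
    (by
      intro i
      by_cases hi : i = (⟨0, hk⟩ : Fin k)
      · simp only [hi, if_true, hξ0]; exact L0
      · simp only [hi, if_false]; exact L1 i hi)
  rw [sum_ite_eq_add] at hsum
  have eDG : ∫ τ in Ioi (0 : ℝ), (D τ - G τ) * τ ^ (-(1 + 2 * s)) =
      (∫ τ in Ioi (0 : ℝ), D τ * τ ^ (-(1 + 2 * s))) -
      ∫ τ in Ioi (0 : ℝ), G τ * τ ^ (-(1 + 2 * s)) := by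
    rw [← integral_sub iD iG.integrableOn]
    congr 1; ext τ; ring
  rw [eDG, eG, eD, eP] at hsum
  rw [cFun_eq, cFun_eq]
  linarith

end Radial

end FracTrunc

namespace FracTrunc

/-! ### Existence above the critical exponent -/

section Existence

variable {N k : ℕ} {s : ℝ}

/-- The function `c (1 + |x|²)^{-γ/2}`. -/
noncomputable def bubble (N : ℕ) (c γ : ℝ) (x : EuclideanSpace ℝ (Fin N)) : ℝ :=
  c * (1 + ‖x‖ ^ 2) ^ (-γ / 2)

lemma continuous_bubble (c γ : ℝ) : Continuous (bubble N c γ) :=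
  continuous_const.mul ((continuous_const.add (continuous_norm.pow 2)).rpow_const
    fun x => Or.inl (show 1 + ‖x‖ ^ 2 ≠ 0 by positivity))

lemma bubble_pos {c : ℝ} (hc : 0 < c) (γ : ℝ) (x : EuclideanSpace ℝ (Fin N)) :
    0 < bubble N c γ x := by unfold bubble; positivity

lemma bubble_le {c γ : ℝ} (hc : 0 < c) (hγ : 0 < γ) (x : EuclideanSpace ℝ (Fin N)) :
    bubble N c γ x ≤ c := by
  have := Real.rpow_le_one_of_one_le_of_nonpos (show 1 ≤ 1 + ‖x‖ ^ 2 by nlinarith [sq_nonneg ‖x‖])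
    (show -γ / 2 ≤ 0 by linarith)
  unfold bubble
  nlinarith

lemma bubble_eq (c γ : ℝ) {R : ℝ} {x : EuclideanSpace ℝ (Fin N)} (hR : 0 < R)
    (hx : 1 + ‖x‖ ^ 2 = R ^ 2) : bubble N c γ x = c * R ^ (-γ) := by
  rw [bubble, hx, ← abs_rpow_neg_eq, abs_of_pos hR]

/-- Apply `rpow_neg_chord` with `a = R² + τ²`, `b = 2Rτ`: the actual points correspond to `θ = ⟨x,
ξ⟩/R`, while `θ = ±1` gives `(R ± τ)²`, the radial increment of a pure power at distance `R`. -/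
lemma bubble_second_difference_le {c γ R τ : ℝ} {x ξ : EuclideanSpace ℝ (Fin N)} (hc : 0 < c)
    (hγ : γ ∈ Ioo (0 : ℝ) 1) (hR : 0 < R) (hx : 1 + ‖x‖ ^ 2 = R ^ 2) (hξ : ‖ξ‖ = 1) (hτ : 0 < τ)
    (hτR : τ ≠ R) :
    bubble N c γ (x + τ • ξ) + bubble N c γ (x - τ • ξ) - 2 * bubble N c γ x ≤
      c * R ^ (-γ) * ((1 - (inner ℝ x ξ / R) ^ 2) * (2 * perpDiff γ (τ / R)) +
        (inner ℝ x ξ / R) ^ 2 * hatDiff γ (τ / R)) := by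
  set θ := inner ℝ x ξ / R with hθ
  have hxR : ‖x‖ ≤ R := by nlinarith [norm_nonneg x]
  have hθ1 : θ ^ 2 ≤ 1 := by
    have h1 := abs_real_inner_le_norm x ξ
    rw [hξ, mul_one] at h1
    rw [hθ, div_pow, div_le_one (by positivity), ← sq_abs]
    exact pow_le_pow_left₀ (abs_nonneg _) (h1.trans hxR) 2
  have hab : |2 * R * τ| < R ^ 2 + τ ^ 2 := by
    rw [abs_of_pos (by positivity)]
    nlinarith [sq_pos_of_ne_zero (sub_ne_zero.2 hτR)]
  have hα : γ / 2 ∈ Ioo (0 : ℝ) 1 := ⟨by linarith [hγ.1], by linarith [hγ.2]⟩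
  have key := rpow_neg_chord hα hab hθ1
  have hθR : θ * (2 * R * τ) = 2 * τ * inner ℝ x ξ := by rw [hθ]; field_simp
  have e1 : R ^ 2 + τ ^ 2 + θ * (2 * R * τ) = 1 + ‖x + τ • ξ‖ ^ 2 := by
    rw [hθR, norm_add_sq_real, inner_smul_right, norm_smul, hξ, Real.norm_eq_abs, mul_one, sq_abs]
    linarith
  have e2 : R ^ 2 + τ ^ 2 - θ * (2 * R * τ) = 1 + ‖x - τ • ξ‖ ^ 2 := by
    rw [hθR, norm_sub_sq_real, inner_smul_right, norm_smul, hξ, Real.norm_eq_abs, mul_one, sq_abs]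
    linarith
  have e3 : R ^ 2 + τ ^ 2 + 2 * R * τ = (R + τ) ^ 2 := by ring
  have e4 : R ^ 2 + τ ^ 2 - 2 * R * τ = (R - τ) ^ 2 := by ring
  rw [e1, e2, e3, e4, ← neg_div, ← abs_rpow_neg_eq, ← abs_rpow_neg_eq] at key
  have h1 := hatDiff_comp_div (γ := γ) hR τ
  have h2 := perpDiff_comp_div (γ := γ) hR τ
  have h3 : (R : ℝ) ^ (-γ) * ((1 - θ ^ 2) * (2 * perpDiff γ (τ / R)) + θ ^ 2 * hatDiff γ (τ / R)) =
      (1 - θ ^ 2) * (2 * (R ^ (-γ) * perpDiff γ (τ / R))) +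
        θ ^ 2 * (R ^ (-γ) * hatDiff γ (τ / R)) := by ring
  rw [bubble_eq c γ hR hx, mul_assoc, h3, ← h1, ← h2]
  unfold bubble
  have := mul_le_mul_of_nonneg_left key hc.le
  linarith

lemma integrableOn_bubble_line {c γ δ : ℝ} (hs : 0 < s) (hc : 0 < c) (hγ : 0 < γ) (hδ : 0 < δ)
    {ℓ : ℝ → EuclideanSpace ℝ (Fin N)} (hℓ : Continuous ℓ) (x : EuclideanSpace ℝ (Fin N)) :
    IntegrableOn (fun τ => (bubble N c γ (ℓ τ) - bubble N c γ x) * τ ^ (-(1 + 2 * s))) (Ioi δ) := by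
  have hmeas : Measurable fun τ => bubble N c γ (ℓ τ) :=
    ((continuous_bubble c γ).comp hℓ).measurable
  refine ((integrableOn_kernel hs hδ).const_mul c).mono' (by fun_prop) ?_
  refine (ae_restrict_mem measurableSet_Ioi).mono fun τ hτ => ?_
  have hk := Real.rpow_nonneg (hδ.trans hτ).le (-(1 + 2 * s))
  rw [norm_mul, Real.norm_of_nonneg hk, Real.norm_eq_abs]
  gcongr
  have h1 := bubble_pos hc γ x
  have h2 := bubble_le hc hγ x
  have h3 := bubble_pos hc γ (ℓ τ)
  have h4 := bubble_le hc hγ (ℓ τ)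
  rw [abs_le]
  constructor <;> linarith

lemma finset_sum_le_coe {ι : Type*} (S : Finset ι) {L : ι → ℝ} {M : ι → EReal}
    (h : ∀ i ∈ S, M i ≤ (L i : EReal)) : ∑ i ∈ S, M i ≤ ((∑ i ∈ S, L i : ℝ) : EReal) := by
  have : ((∑ i ∈ S, L i : ℝ) : EReal) = ∑ i ∈ S, (L i : EReal) :=
    map_sum (⟨⟨Real.toEReal, EReal.coe_zero⟩, EReal.coe_add⟩ : ℝ →+ EReal) L S
  rw [this]
  exact Finset.sum_le_sum h

/-- Only `∑ θ_i²` matters for the frame sum, and it enters with the nonnegative coefficient `hatInt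
- 2 perpInt`; replacing it by its upper bound `1` yields `c_k(γ)`. -/
lemma maxOp_bubble_le (hs : 0 < s) (hs1 : s < 1) {c γ R δ : ℝ} (hc : 0 < c)
    (hγ : γ ∈ Ioo (0 : ℝ) 1) {x : EuclideanSpace ℝ (Fin N)} (hR : 0 < R)
    (hx : 1 + ‖x‖ ^ 2 = R ^ 2) (hδ : 0 < δ) {φ : EuclideanSpace ℝ (Fin N) → ℝ}
    (hmin : ∀ y ∈ Metric.ball x δ, bubble N c γ x - φ x ≤ bubble N c γ y - φ y) :
    maxOp k s (bubble N c γ) φ x δ ≤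
      ((c * R ^ (-γ) * R ^ (-(2 * s)) * cFun k s γ : ℝ) : EReal) := by
  refine iSup_le fun ⟨ξ, hξ⟩ => ?_
  set q : Fin k → ℝ := fun i => (inner ℝ x (ξ i) / R) ^ 2 with hq
  set D : Fin k → ℝ → ℝ := fun i τ => c * R ^ (-γ) *
    ((1 - q i) * (2 * perpDiff γ (τ / R)) + q i * hatDiff γ (τ / R)) with hD
  have iP := integrableOn_comp_div_kernel hR (integrableOn_perpDiff hs hs1 hγ)
  have iH := integrableOn_comp_div_kernel hR (integrableOn_hatDiff hs hs1 hγ)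
  have eD' : ∀ i τ, D i τ * τ ^ (-(1 + 2 * s)) =
      c * R ^ (-γ) * (1 - q i) * 2 * (perpDiff γ (τ / R) * τ ^ (-(1 + 2 * s))) +
      c * R ^ (-γ) * q i * (hatDiff γ (τ / R) * τ ^ (-(1 + 2 * s))) := fun i τ => by
    simp only [hD]; ring
  have iD : ∀ i, IntegrableOn (fun τ => D i τ * τ ^ (-(1 + 2 * s))) (Ioi 0) := fun i => by
    simp only [eD']
    exact (iP.const_mul _).add (iH.const_mul _)
  have eD : ∀ i, ∫ τ in Ioi (0 : ℝ), D i τ * τ ^ (-(1 + 2 * s)) =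
      c * R ^ (-γ) * R ^ (-(2 * s)) *
        (2 * perpInt s γ + q i * (hatInt s γ - 2 * perpInt s γ)) := fun i => by
    simp only [eD']
    rw [integral_add (iP.const_mul _) (iH.const_mul _), integral_const_mul, integral_const_mul,
      integral_comp_div_kernel _ hR, integral_comp_div_kernel _ hR, perpInt, hatInt]
    ring
  have hdiff : ∀ i, ∀ᵐ τ : ℝ, 0 < τ → bubble N c γ (x + τ • ξ i) + bubble N c γ (x - τ • ξ i) -
      2 * bubble N c γ x ≤ D i τ := fun i => by
    filter_upwards [Measure.ae_ne volume R] with τ hτR hτ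
    exact bubble_second_difference_le hc hγ hR hx (hξ.1 i) hτ hτR
  have hL : ∀ i ∈ Finset.univ, innerPart s φ x δ (ξ i) + outerPart s (bubble N c γ) x δ (ξ i) ≤
      ((Cs s * ∫ τ in Ioi (0 : ℝ), D i τ * τ ^ (-(1 + 2 * s)) : ℝ) : EReal) := by
    intro i _
    refine innerPart_add_outerPart_le hs hs1 hδ (iD i)
      (integrableOn_bubble_line hs hc hγ.1 hδ (by fun_prop) x)
      (integrableOn_bubble_line hs hc hγ.1 hδ (by fun_prop) x) ?_
      ((hdiff i).mono fun τ h hτ => h (hδ.trans hτ))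
    filter_upwards [hdiff i] with τ h hτ
    have hn : ‖τ • ξ i‖ < δ := by
      rw [norm_smul, hξ.1 i, mul_one, Real.norm_of_nonneg hτ.1.le]; exact hτ.2
    have h1 := hmin (x + τ • ξ i) (by simpa [Metric.mem_ball, dist_eq_norm] using hn)
    have h2 := hmin (x - τ • ξ i) (by simpa [Metric.mem_ball, dist_eq_norm] using hn)
    linarith [h hτ.1]
  refine (finset_sum_le_coe _ hL).trans (EReal.coe_le_coe_iff.2 ?_)
  simp only [eD]
  have hC := Cs_pos hs hs1
  have hRγ : 0 < R ^ (-γ) := Real.rpow_pos_of_pos hR _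
  have hRs : 0 < R ^ (-(2 * s)) := Real.rpow_pos_of_pos hR _
  -- Bessel's inequality, together with `‖x‖ ≤ R`.
  have hsumq : ∑ i, q i ≤ 1 := by
    have hB := hξ.sum_inner_products_le x (s := Finset.univ)
    have : ∑ i, q i = (∑ i, ‖inner ℝ (ξ i) x‖ ^ 2) / R ^ 2 := by
      rw [Finset.sum_div]
      refine Finset.sum_congr rfl fun i _ => ?_
      simp only [hq]
      rw [Real.norm_eq_abs, sq_abs, real_inner_comm, div_pow]
    rw [this, div_le_one (by positivity)]
    linarith
  have hnn : 0 ≤ hatInt s γ - 2 * perpInt s γ := by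
    linarith [two_mul_perpInt_le_hatInt hs hs1 hγ]
  have e : ∑ i, Cs s * (c * R ^ (-γ) * R ^ (-(2 * s)) *
      (2 * perpInt s γ + q i * (hatInt s γ - 2 * perpInt s γ))) =
      Cs s * (c * R ^ (-γ) * R ^ (-(2 * s))) * (2 * k * perpInt s γ +
        (∑ i, q i) * (hatInt s γ - 2 * perpInt s γ)) := by
    rw [← Finset.mul_sum, ← Finset.mul_sum, Finset.sum_add_distrib, Finset.sum_mul]
    simp only [Finset.sum_const, Finset.card_univ, Fintype.card_fin, nsmul_eq_mul]
    ring
  rw [e, cFun_eq]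
  have h1 := mul_le_mul_of_nonneg_right hsumq hnn
  have h2 : 2 * k * perpInt s γ + (∑ i, q i) * (hatInt s γ - 2 * perpInt s γ) ≤
      hatInt s γ + 2 * ((k : ℝ) - 1) * perpInt s γ := by linarith
  have h3 := mul_le_mul_of_nonneg_left h2
    (show 0 ≤ Cs s * (c * R ^ (-γ) * R ^ (-(2 * s))) by positivity)
  linarith

theorem bubble_isViscositySupersolution (hs : 0 < s) (hs1 : s < 1) {γ p : ℝ}
    (hγ : γ ∈ Ioo (0 : ℝ) 1) (hneg : cFun k s γ < 0) (hp : γ * p = γ + 2 * s) :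
    IsViscositySupersolution k s (fun t => t ^ p) (bubble N ((-cFun k s γ) ^ (1 / (p - 1))) γ) := by
  have hp1 : 0 < p - 1 := by nlinarith [hγ.1]
  have hneg' : 0 < -cFun k s γ := by linarith
  set c := (-cFun k s γ) ^ (1 / (p - 1)) with hc_def
  have hc : 0 < c := Real.rpow_pos_of_pos hneg' _
  refine ⟨(continuous_bubble c γ).lowerSemicontinuous, fun x δ φ hδ _ hmin => ?_⟩
  set R := Real.sqrt (1 + ‖x‖ ^ 2) with hR_def
  have hR : 0 < R := Real.sqrt_pos.2 (by positivity)
  have hx : 1 + ‖x‖ ^ 2 = R ^ 2 := (Real.sq_sqrt (by positivity)).symm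
  -- The constant satisfies `c^{p-1} = -c_k(γ)`, while `γ p = γ + 2s` matches the powers of `R`; the
  -- equation then holds with the upper bound for the operator.
  have hcp : c ^ p = c * (-cFun k s γ) := by
    have : c ^ (p - 1) = -cFun k s γ := by
      rw [hc_def, ← Real.rpow_mul hneg'.le, one_div_mul_cancel hp1.ne', Real.rpow_one]
    rw [← this]
    rw [← Real.rpow_one_add' hc.le (by linarith)]
    congr 1; ring
  have hup : bubble N c γ x ^ p = c * R ^ (-γ) * R ^ (-(2 * s)) * (-cFun k s γ) := by
    rw [bubble_eq c γ hR hx, Real.mul_rpow hc.le (Real.rpow_nonneg hR.le _), hcp,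
      ← Real.rpow_mul hR.le, show -γ * p = -γ + -(2 * s) by linarith, Real.rpow_add hR]
    ring
  refine (add_le_add_left (maxOp_bubble_le hs hs1 hc hγ hR hx hδ hmin) _).trans ?_
  rw [← EReal.coe_add]
  beta_reduce
  rw [hup]
  norm_cast
  linarith

end Existence

end FracTrunc

namespace FracTrunc

/-! ### Nonexistence: basic tests -/

section Tests

variable {N k : ℕ} {s : ℝ} {f : ℝ → ℝ} {u : EuclideanSpace ℝ (Fin N) → ℝ}

/-- Strong maximum principle. -/
theorem IsViscositySupersolution.pos (hk : 1 ≤ k) (hkN : k ≤ N) (hs : 0 < s) (hs1 : s < 1)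
    (hf : 0 ≤ f 0) (hu : IsViscositySupersolution k s f u) (hnn : ∀ x, 0 ≤ u x)
    {z : EuclideanSpace ℝ (Fin N)} (hz : u z ≠ 0) (x : EuclideanSpace ℝ (Fin N)) : 0 < u x := by
  by_contra hx
  have hx : u x = 0 := le_antisymm (not_lt.1 hx) (hnn x)
  have hzp : 0 < u z := lt_of_le_of_ne (hnn z) (Ne.symm hz)
  set t := ‖z - x‖ with ht_def
  have ht : 0 < t := norm_pos_iff.2 (sub_ne_zero.2 fun h => hz (h ▸ hx))
  obtain ⟨ρ₀, hρ₀, hball⟩ := Metric.eventually_nhds_iff.1 (hu.1 z (u z / 2) (by linarith))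
  set ρ := min ρ₀ (t / 2) with hρ_def
  have hρ : 0 < ρ := lt_min hρ₀ (by linarith)
  have hρt : ρ ≤ t / 2 := min_le_right _ _
  obtain ⟨ξ, hξ, hξ0⟩ := exists_orthonormal_frame hkN ⟨0, hk⟩ (e := t⁻¹ • (z - x))
    (by rw [norm_smul, norm_inv, norm_norm, inv_mul_cancel₀ ht.ne'])
  -- At a zero of `u` the function `0` touches from below. One frame vector points towards `z`, and
  -- by lower semicontinuity `u ≥ u(z)/2` on a segment around `z`, making the operator strictly
  -- positive.
  set W : ℝ → ℝ := (Ioo (t - ρ) (t + ρ)).indicator fun _ => u z / 2 with hW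
  have hW0 : ∀ τ, τ ∉ Ioo (t - ρ) (t + ρ) → W τ = 0 := fun τ h => indicator_of_notMem h _
  have hWneg : ∀ τ, 0 < τ → W (-τ) = 0 := fun τ h => hW0 _ fun h' => by linarith [h'.1]
  have hWk : (fun τ => W τ * τ ^ (-(1 + 2 * s))) = (Ioo (t - ρ) (t + ρ)).indicator
      fun τ => u z / 2 * τ ^ (-(1 + 2 * s)) := by
    ext τ
    by_cases hτ : τ ∈ Ioo (t - ρ) (t + ρ)
    · rw [hW, indicator_of_mem hτ, indicator_of_mem hτ]
    · rw [hW, indicator_of_notMem hτ, indicator_of_notMem hτ, zero_mul]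
  have hδ : 0 < t / 3 := by linarith
  have hsub : Ioo (t - ρ) (t + ρ) ⊆ Ioi (t / 3) := fun τ hτ =>
    show t / 3 < τ by linarith [hτ.1]
  have hsub0 : Ioo (t - ρ) (t + ρ) ⊆ Ioi 0 := hsub.trans (Ioi_subset_Ioi hδ.le)
  have iW' : IntegrableOn (fun τ => u z / 2 * τ ^ (-(1 + 2 * s))) (Ioo (t - ρ) (t + ρ)) :=
    IntegrableOn.mono_set ((integrableOn_kernel hs hδ).const_mul (u z / 2)) hsub
  have iW : Integrable (fun τ => W τ * τ ^ (-(1 + 2 * s))) := by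
    rw [hWk]; exact iW'.integrable_indicator measurableSet_Ioo
  have hpos : 0 < ∫ τ in Ioi (0 : ℝ), W τ * τ ^ (-(1 + 2 * s)) := by
    have hp : ∀ τ ∈ Ioo (t - ρ) (t + ρ), 0 < u z / 2 * τ ^ (-(1 + 2 * s)) := fun τ hτ =>
      mul_pos (by linarith) (Real.rpow_pos_of_pos (hsub0 hτ) _)
    rw [hWk, setIntegral_indicator measurableSet_Ioo, inter_eq_self_of_subset_right hsub0,
      setIntegral_pos_iff_support_of_nonneg_ae _ iW']
    · refine lt_of_lt_of_le ?_ (measure_mono (s := Ioo (t - ρ) (t + ρ)) ?_)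
      · rw [Real.volume_Ioo, ENNReal.ofReal_pos]; linarith
      · exact fun τ hτ => ⟨(hp τ hτ).ne', hτ⟩
    · exact (ae_restrict_mem measurableSet_Ioo).mono fun τ hτ => (hp τ hτ).le
  have hsum := hu.sum_add_le (φ := fun _ => 0) (x := x) hδ contDiffOn_const
    (fun y _ => by rw [hx]; simpa using hnn y) hξ
    (L := fun i => if i = (⟨0, hk⟩ : Fin k) then
        Cs s * ∫ τ in Ioi (0 : ℝ), W τ * τ ^ (-(1 + 2 * s)) else 0)
    (by
      intro i
      by_cases hi : i = (⟨0, hk⟩ : Fin k)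
      · simp only [hi, if_true, hξ0]
        refine le_innerPart_add_outerPart hs hs1 hδ (W := W) iW.integrableOn iW.integrableOn
          ?_ ?_ ?_ ?_
        · refine integrableOn_zero.congr_fun (fun τ hτ => ?_) measurableSet_Ioi
          rw [hWneg τ (hδ.trans hτ), zero_mul]
        · intro τ hτ; rw [hWneg τ (hδ.trans hτ), add_zero]
        · intro τ hτ
          rw [hW0 τ fun h => by linarith [h.1, hτ.2]]
          simp
        · intro τ _
          rw [hx, sub_zero]
          by_cases hτ : τ ∈ Ioo (t - ρ) (t + ρ)
          · rw [hW, indicator_of_mem hτ]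
            refine (hball ?_).le
            have e : x + τ • (t⁻¹ • (z - x)) - z = ((τ - t) * t⁻¹) • (z - x) := by
              rw [sub_mul, mul_inv_cancel₀ ht.ne', sub_smul, one_smul, smul_smul]
              abel
            rw [dist_eq_norm, e, norm_smul, norm_mul, norm_inv, ← ht_def,
              Real.norm_of_nonneg ht.le, inv_mul_cancel_right₀ ht.ne', Real.norm_eq_abs]
            refine lt_of_lt_of_le (abs_lt.2 ⟨?_, ?_⟩) (min_le_left ρ₀ (t / 2))
            · linarith [hτ.1]
            · linarith [hτ.2]
          · rw [hW0 τ hτ]; exact hnn _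
      · simp only [hi, if_false]
        have := le_innerPart_add_outerPart (u := u) (φ := fun _ => 0) (x := x) (ξ := ξ i) hs hs1 hδ
          (D := fun _ => 0) (W := fun _ => 0) (by simp) (by simp) (by simp) (by simp) (by simp)
          (fun τ _ => by rw [hx, sub_zero]; exact hnn _)
        simpa using this)
  rw [sum_ite_eq_add, mul_zero, add_zero, hx] at hsum
  have := mul_pos (Cs_pos hs hs1) hpos
  linarith

/-- Testing with a concave paraboloid. -/
theorem IsViscositySupersolution.exists_le (hkN : k ≤ N) (hs : 0 < s) (hs1 : s < 1)
    (hu : IsViscositySupersolution k s f u) (hpos : ∀ x, 0 < u x) {R : ℝ} (hR : 0 < R)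
    {y : EuclideanSpace ℝ (Fin N)} (hy : ‖y‖ ≤ R) :
    ∃ x, ‖x‖ ≤ 2 * R ∧ u x ≤ 4 / 3 * u y ∧
      f (u x) ≤ 8 / 3 * k * Cs s * minInt s * u y * R ^ (-(2 * s)) := by
  have hm := hpos y
  -- The factor `4/3` ensures `φ(y) ≥ u(y)` when `‖y‖ ≤ R`, since there `1 - ‖y‖²/(4R²) ≥ 3/4`. As
  -- `φ ≤ 0` beyond radius `2R`, the minimum over the ball is global.
  set c := 4 / 3 * u y with hc_def
  have hc : 0 < c := by positivity
  set φ : EuclideanSpace ℝ (Fin N) → ℝ := fun z => c * (1 - ‖z‖ ^ 2 / (4 * R ^ 2)) with hφ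
  have hφC : ContDiff ℝ 2 φ :=
    contDiff_const.mul (contDiff_const.sub ((contDiff_norm_sq ℝ).div_const _))
  obtain ⟨x, hxR, hx⟩ := LowerSemicontinuousOn.exists_isMinOn
    (s := Metric.closedBall (0 : EuclideanSpace ℝ (Fin N)) (2 * R))
    (f := fun z => u z + -φ z) ⟨y, by rw [mem_closedBall_zero_iff]; linarith⟩
    (isCompact_closedBall _ _)
    ((hu.1.add hφC.continuous.neg.lowerSemicontinuous).lowerSemicontinuousOn _)
  rw [mem_closedBall_zero_iff] at hxR
  have hφy : u y ≤ φ y := by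
    have : ‖y‖ ^ 2 / (4 * R ^ 2) ≤ 1 / 4 := by
      rw [div_le_iff₀ (by positivity)]
      nlinarith [norm_nonneg y]
    simp only [hφ, hc_def]
    nlinarith
  have hx0 : u x ≤ φ x := by
    have := hx (show y ∈ Metric.closedBall 0 (2 * R) by rw [mem_closedBall_zero_iff]; linarith)
    simp only [mem_ofPred_eq] at this
    linarith
  have hmin : ∀ z, u x - φ x ≤ u z - φ z := by
    intro z
    by_cases hz : ‖z‖ ≤ 2 * R
    · have := hx (show z ∈ Metric.closedBall 0 (2 * R) by rw [mem_closedBall_zero_iff]; exact hz)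
      simp only [mem_ofPred_eq] at this
      linarith
    · have : 1 ≤ ‖z‖ ^ 2 / (4 * R ^ 2) := by
        rw [le_div_iff₀ (by positivity)]; nlinarith
      have h2 : φ z ≤ 0 := by simp only [hφ]; nlinarith
      linarith [hpos z]
  have hxc : u x ≤ c := by
    have : 0 ≤ ‖x‖ ^ 2 / (4 * R ^ 2) := by positivity
    have : φ x ≤ c := by simp only [hφ]; nlinarith
    linarith
  refine ⟨x, hxR, hxc, ?_⟩
  -- For `τ ≥ R` this uses `u ≥ 0` and `u(x) ≤ c`; for `τ < R` the paraboloid's second difference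
  -- `-(c/2)(τ/R)²` is better than the required `-2c(τ/R)²`.
  set W : ℝ → ℝ := fun τ => -c * min ((τ / R) ^ 2) 1 with hW
  have hWn : ∀ τ, W (-τ) = W τ := fun τ => by simp only [hW, neg_div, neg_sq]
  have iM := integrableOn_comp_div_kernel (h := fun τ => min (τ ^ 2) 1) hR
    (integrableOn_min_kernel hs hs1)
  have iW : IntegrableOn (fun τ => W τ * τ ^ (-(1 + 2 * s))) (Ioi 0) :=
    IntegrableOn.congr_fun (iM.const_mul (-c)) (fun τ _ => by simp only [hW]; ring)
      measurableSet_Ioi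
  have eW : ∫ τ in Ioi (0 : ℝ), (W τ + W τ) * τ ^ (-(1 + 2 * s)) =
      -(2 * c) * (R ^ (-(2 * s)) * minInt s) := by
    rw [minInt, ← integral_comp_div_kernel (fun τ => min (τ ^ 2) 1) hR, ← integral_const_mul]
    congr 1; ext τ; simp only [hW]; ring
  have hframe : Orthonormal ℝ fun i : Fin k =>
      EuclideanSpace.basisFun (Fin N) ℝ (Fin.castLE hkN i) :=
    (EuclideanSpace.basisFun (Fin N) ℝ).orthonormal.comp _ (Fin.castLE_injective hkN)
  have hsum := hu.sum_add_le (φ := φ) (x := x) hR hφC.contDiffOn (fun z _ => hmin z) hframe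
    (L := fun _ => Cs s * ∫ τ in Ioi (0 : ℝ), (W τ + W τ) * τ ^ (-(1 + 2 * s)))
    (by
      intro i
      have hξ := hframe.1 i
      refine le_innerPart_add_outerPart hs hs1 hR (W := W)
        (IntegrableOn.congr_fun (iW.add iW) (fun τ _ => by simp only [Pi.add_apply]; ring)
          measurableSet_Ioi) (iW.mono_set (Ioi_subset_Ioi hR.le)) ?_ ?_ ?_ ?_
      · simp only [hWn]; exact iW.mono_set (Ioi_subset_Ioi hR.le)
      · intro τ _; rw [hWn]
      · intro τ hτ
        have hpar := parallelogram_law_with_norm ℝ x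
          (τ • EuclideanSpace.basisFun (Fin N) ℝ (Fin.castLE hkN i))
        have hn : ‖τ • EuclideanSpace.basisFun (Fin N) ℝ (Fin.castLE hkN i)‖ = τ := by
          rw [norm_smul, hξ, mul_one, Real.norm_of_nonneg hτ.1.le]
        rw [hn] at hpar
        have hle : (τ / R) ^ 2 ≤ 1 := by
          rw [div_pow, div_le_one (by positivity)]; nlinarith [hτ.1, hτ.2]
        have e : φ (x + τ • EuclideanSpace.basisFun (Fin N) ℝ (Fin.castLE hkN i)) +
            φ (x - τ • EuclideanSpace.basisFun (Fin N) ℝ (Fin.castLE hkN i)) - 2 * φ x =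
            -(c / 2) * (τ / R) ^ 2 := by
          simp only [hφ]
          field_simp
          linear_combination (-2) * hpar
        rw [e]
        simp only [hW]
        rw [min_eq_left hle]
        nlinarith [mul_nonneg hc.le (sq_nonneg (τ / R))]
      · intro τ hτ
        have hle : 1 ≤ (τ / R) ^ 2 := by
          rw [div_pow, one_le_div (by positivity), ← sq_abs τ]
          exact pow_le_pow_left₀ hR.le hτ 2
        simp only [hW]
        rw [min_eq_right hle]
        linarith [hpos (x + τ • EuclideanSpace.basisFun (Fin N) ℝ (Fin.castLE hkN i))])
  simp only [Finset.sum_const, Finset.card_univ, Fintype.card_fin, nsmul_eq_mul, eW] at hsum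
  rw [hc_def] at hsum
  linarith

/-- Since `v` decays and `u ≥ 0`, a negative value of `u - v` confines the minimization to a compact
set. -/
lemma exists_contact {v : EuclideanSpace ℝ (Fin N) → ℝ} (hu : LowerSemicontinuous u)
    (hnn : ∀ x, 0 ≤ u x) {r₀ : ℝ} (hv : ContinuousOn v {y | r₀ ≤ ‖y‖})
    (hdecay : ∀ η : ℝ, 0 < η → ∃ R, ∀ y : EuclideanSpace ℝ (Fin N), R ≤ ‖y‖ → v y < η)
    {z : EuclideanSpace ℝ (Fin N)} (hz : r₀ ≤ ‖z‖) (hlt : u z < v z) :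
    ∃ x, r₀ ≤ ‖x‖ ∧ u x < v x ∧ ∀ y, r₀ ≤ ‖y‖ → u x - v x ≤ u y - v y := by
  obtain ⟨R, hR⟩ := hdecay (v z - u z) (by linarith)
  set K := {y : EuclideanSpace ℝ (Fin N) | r₀ ≤ ‖y‖} ∩ Metric.closedBall 0 (max R ‖z‖) with hK
  have hKc : IsCompact K :=
    (isCompact_closedBall _ _).inter_left (isClosed_le continuous_const continuous_norm)
  have hzK : z ∈ K := ⟨hz, by rw [mem_closedBall_zero_iff]; exact le_max_right _ _⟩
  obtain ⟨x, hxK, hx⟩ := LowerSemicontinuousOn.exists_isMinOn (f := fun y => u y + -v y)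
    ⟨z, hzK⟩ hKc ((hu.lowerSemicontinuousOn K).add
      (hv.mono inter_subset_left).neg.lowerSemicontinuousOn)
  have hxz : u x + -v x ≤ u z + -v z := hx hzK
  refine ⟨x, hxK.1, by linarith, fun y hy => ?_⟩
  by_cases hyR : ‖y‖ ≤ max R ‖z‖
  · have : u x + -v x ≤ u y + -v y := hx ⟨hy, by rw [mem_closedBall_zero_iff]; exact hyR⟩
    linarith
  · have := hR y ((le_max_left _ _).trans (not_le.1 hyR).le)
    linarith [hnn y]

end Tests

end FracTrunc

namespace FracTrunc

/-! ### Nonexistence: lower bounds at infinity -/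

section LowerBounds

variable {N k : ℕ} {s : ℝ} {f : ℝ → ℝ} {u : EuclideanSpace ℝ (Fin N) → ℝ}

lemma integral_abs_sub_rpow {γ ε : ℝ} (hγ : γ < 1) (hε : 0 < ε) (r : ℝ) :
    IntegrableOn (fun τ => |r - τ| ^ (-γ)) (Ioo (r - ε) (r + ε)) ∧
      ∫ τ in Ioo (r - ε) (r + ε), |r - τ| ^ (-γ) = 2 * (ε ^ (1 - γ) / (1 - γ)) := by
  have i1 : IntervalIntegrable (fun t : ℝ => |t| ^ (-γ)) volume 0 ε := by
    rw [intervalIntegrable_iff_integrableOn_Ioc_of_le hε.le]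
    refine IntegrableOn.congr_fun ((intervalIntegrable_iff_integrableOn_Ioc_of_le hε.le).1
      (intervalIntegral.intervalIntegrable_rpow' (show -1 < -γ by linarith))) (fun t ht => ?_)
      measurableSet_Ioc
    simp only [abs_of_pos ht.1]
  have i2 : IntervalIntegrable (fun t : ℝ => |t| ^ (-γ)) volume (-ε) 0 := by
    have := i1.comp_sub_left 0
    simpa using this.symm
  have e1 : ∫ t in (0 : ℝ)..ε, |t| ^ (-γ) = ε ^ (1 - γ) / (1 - γ) := by
    have : ∫ t in (0 : ℝ)..ε, |t| ^ (-γ) = ∫ t in (0 : ℝ)..ε, t ^ (-γ) := by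
      refine intervalIntegral.integral_congr fun t ht => ?_
      rw [uIcc_of_le hε.le] at ht
      simp only [abs_of_nonneg ht.1]
    rw [this, integral_rpow (Or.inl (by linarith)), Real.zero_rpow (by linarith), sub_zero,
      show -γ + 1 = 1 - γ by ring]
  have e2 : ∫ t in (-ε)..0, |t| ^ (-γ) = ε ^ (1 - γ) / (1 - γ) := by
    have := intervalIntegral.integral_comp_neg (fun t : ℝ => |t| ^ (-γ)) (a := 0) (b := ε)
    simp only [abs_neg, neg_zero] at this
    rw [← this, e1]
  have i3 := (i2.trans i1).comp_sub_left r
  have hle : r - ε ≤ r + ε := by linarith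
  rw [show r - -ε = r + ε by ring] at i3
  refine ⟨((intervalIntegrable_iff_integrableOn_Ioo_of_le hle).1 i3.symm), ?_⟩
  rw [← integral_Ioc_eq_integral_Ioo, ← intervalIntegral.integral_of_le hle,
    intervalIntegral.integral_comp_sub_left (fun t : ℝ => |t| ^ (-γ)) r,
    show r - (r + ε) = -ε by ring, show r - (r - ε) = ε by ring,
    ← intervalIntegral.integral_add_adjacent_intervals i2 i1, e1, e2]
  ring

lemma continuousOn_norm_rpow (γ : ℝ) :
    ContinuousOn (fun y : EuclideanSpace ℝ (Fin N) => ‖y‖ ^ (-γ)) {0}ᶜ :=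
  continuous_norm.continuousOn.rpow_const fun _ hy => Or.inl (norm_ne_zero_iff.2 hy)

lemma exists_rpow_neg_lt {γ : ℝ} (hγ : 0 < γ) {η : ℝ} (hη : 0 < η) :
    ∃ R : ℝ, ∀ t : ℝ, R ≤ t → t ^ (-γ) < η :=
  eventually_atTop.1 ((tendsto_rpow_neg_atTop hγ).eventually_lt_const hη)

/-- A positive supersolution decays at most like `|x|^{-γ}` when `c_k(γ) = 0`. -/
theorem IsViscositySupersolution.exists_lower_bound (hk : 1 ≤ k) (hkN : k ≤ N) (hs : 0 < s)
    (hs1 : s < 1) (hf : ∀ t, 0 < t → 0 ≤ f t) (hu : IsViscositySupersolution k s f u)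
    (hpos : ∀ x, 0 < u x) {γ γ' : ℝ} (hγ : γ ∈ Ioo (0 : ℝ) 1) (hγ' : γ' ∈ Ioo γ 1)
    (hz : cFun k s γ = 0) (hp : 0 < cFun k s γ') :
    ∃ A : ℝ, 0 < A ∧ ∀ y, 1 ≤ ‖y‖ → A * ‖y‖ ^ (-γ) ≤ u y := by
  have hγ'1 : γ' ∈ Ioo (0 : ℝ) 1 := ⟨hγ.1.trans hγ'.1, hγ'.2⟩
  have h1γ' : 0 < 1 - γ' := by linarith [hγ'.2]
  have hC := Cs_pos hs hs1
  -- the radius of the truncation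
  obtain ⟨ε, hε, hεsmall⟩ : ∃ ε ∈ Ioo (0 : ℝ) (1 / 2),
      Cs s * (2 ^ (1 + 2 * s) * (4 * (ε ^ (1 - γ') / (1 - γ')))) < cFun k s γ' := by
    have ht : Tendsto (fun ε : ℝ => Cs s * (2 ^ (1 + 2 * s) * (4 * (ε ^ (1 - γ') / (1 - γ')))))
        (𝓝[>] 0) (𝓝 0) := by
      have h0 : ContinuousAt (fun ε : ℝ => ε ^ (1 - γ')) 0 :=
        Real.continuousAt_rpow_const _ _ (Or.inr h1γ'.le)
      have h1 : Tendsto (fun ε : ℝ => ε ^ (1 - γ')) (𝓝[>] 0) (𝓝 0) := by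
        have := h0.tendsto
        rw [Real.zero_rpow h1γ'.ne'] at this
        exact this.mono_left nhdsWithin_le_nhds
      have := (((h1.div_const (1 - γ')).const_mul 4).const_mul (2 ^ (1 + 2 * s))).const_mul (Cs s)
      simpa using this
    have h2 : ∀ᶠ ε in 𝓝[>] (0 : ℝ), ε ∈ Ioo (0 : ℝ) (1 / 2) := Ioo_mem_nhdsGT (by norm_num)
    exact (h2.and (ht.eventually_lt_const hp)).exists
  obtain ⟨z₀, hz₀, hzmin⟩ := LowerSemicontinuousOn.exists_isMinOn
    (s := Metric.closedBall (0 : EuclideanSpace ℝ (Fin N)) 1) (f := u) ⟨0, by simp⟩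
    (isCompact_closedBall _ _) (hu.1.lowerSemicontinuousOn _)
  -- Normalized so that `v ≤ min u` over the closed unit ball on `ε ≤ ‖y‖ ≤ 1`, forcing any contact
  -- point outside the unit ball.
  set M := ε ^ (-γ) + ε ^ (-γ') with hM_def
  have hM : 0 < M := add_pos (Real.rpow_pos_of_pos hε.1 _) (Real.rpow_pos_of_pos hε.1 _)
  set a := u z₀ / M with ha_def
  have ha : 0 < a := div_pos (hpos _) hM
  set v : EuclideanSpace ℝ (Fin N) → ℝ := fun y => a * ‖y‖ ^ (-γ) + a * ‖y‖ ^ (-γ') with hv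
  have hin : ∀ y, ε ≤ ‖y‖ → ‖y‖ ≤ 1 → v y ≤ u y := by
    intro y h1 h2
    have b1 := Real.rpow_le_rpow_of_nonpos hε.1 h1 (show -γ ≤ 0 by linarith [hγ.1])
    have b2 := Real.rpow_le_rpow_of_nonpos hε.1 h1 (show -γ' ≤ 0 by linarith [hγ'1.1])
    have b3 : u z₀ ≤ u y := hzmin (show y ∈ Metric.closedBall 0 1 by
      rw [mem_closedBall_zero_iff]; exact h2)
    have b4 : a * M = u z₀ := by rw [ha_def]; field_simp
    simp only [hv]
    nlinarith
  have hcont : ContinuousOn v {y | ε ≤ ‖y‖} := by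
    have hsub : {y : EuclideanSpace ℝ (Fin N) | ε ≤ ‖y‖} ⊆ {0}ᶜ := by
      rintro y hy rfl
      have : ε ≤ ‖(0 : EuclideanSpace ℝ (Fin N))‖ := hy
      rw [norm_zero] at this
      linarith [hε.1]
    exact (continuousOn_const.mul ((continuousOn_norm_rpow γ).mono hsub)).add
      (continuousOn_const.mul ((continuousOn_norm_rpow γ').mono hsub))
  have hdecay : ∀ η : ℝ, 0 < η → ∃ R, ∀ y : EuclideanSpace ℝ (Fin N), R ≤ ‖y‖ → v y < η := by
    intro η hη
    obtain ⟨R₁, h₁⟩ := exists_rpow_neg_lt hγ.1 (show 0 < η / (2 * a) by positivity)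
    obtain ⟨R₂, h₂⟩ := exists_rpow_neg_lt hγ'1.1 (show 0 < η / (2 * a) by positivity)
    refine ⟨max R₁ R₂, fun y hy => ?_⟩
    have c1 := h₁ _ ((le_max_left _ _).trans hy)
    have c2 := h₂ _ ((le_max_right _ _).trans hy)
    rw [lt_div_iff₀ (by positivity)] at c1 c2
    simp only [hv]
    linarith
  refine ⟨a, ha, fun z hz1 => ?_⟩
  have hvz : a * ‖z‖ ^ (-γ) ≤ v z := by
    have := mul_nonneg ha.le (Real.rpow_nonneg (norm_nonneg z) (-γ'))
    simp only [hv]; linarith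
  refine hvz.trans ?_
  by_contra! hlt
  obtain ⟨x, hεx, hx, hmin⟩ := exists_contact hu.1 (fun y => (hpos y).le) hcont hdecay
    (by linarith [hε.2]) hlt
  have hx1 : 1 < ‖x‖ := by
    by_contra! h
    linarith [hin x hεx h]
  set r := ‖x‖ with hr
  have hr0 : 0 < r := by linarith
  -- The power `γ` contributes nothing, as `c_k(γ) = 0`; the added power `γ'` supplies the strictly
  -- positive term that beats the truncation error.
  have htest := radial_test hk hkN hs hs1 hu (x := x) (r := r) (a := a) (b := a) hr.symm hε.1.le
    (by linarith [hε.2]) hγ hγ'1 (fun y hy => by have := hmin y hy; simp only [hv] at this; linarith)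
    (fun y _ => by simp only [hv] at hx; linarith [hpos y])
  have hint : ∫ τ in Ioo (r - ε) (r + ε),
      (a * |r - τ| ^ (-γ) + a * |r - τ| ^ (-γ')) * τ ^ (-(1 + 2 * s)) ≤
      a * (r / 2) ^ (-(1 + 2 * s)) * (4 * (ε ^ (1 - γ') / (1 - γ'))) := by
    obtain ⟨i1, e1⟩ := integral_abs_sub_rpow hγ'.2 hε.1 r
    have i2 : IntegrableOn (fun τ => a * (r / 2) ^ (-(1 + 2 * s)) * (2 * |r - τ| ^ (-γ')))
        (Ioo (r - ε) (r + ε)) := (i1.const_mul 2).const_mul _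
    have e2 : ∫ τ in Ioo (r - ε) (r + ε), a * (r / 2) ^ (-(1 + 2 * s)) * (2 * |r - τ| ^ (-γ')) =
        a * (r / 2) ^ (-(1 + 2 * s)) * (4 * (ε ^ (1 - γ') / (1 - γ'))) := by
      rw [integral_const_mul, integral_const_mul, e1]; ring
    rw [← e2]
    refine integral_mono_of_nonneg ?_ i2 ?_
    · refine (ae_restrict_mem measurableSet_Ioo).mono fun τ hτ => ?_
      have : 0 < τ := by linarith [hτ.1, hε.2]
      simp only [Pi.zero_apply]
      positivity
    · filter_upwards [ae_restrict_mem measurableSet_Ioo,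
        ae_restrict_of_ae (Measure.ae_ne volume r)] with τ hτ hτr
      have hτ0 : 0 < τ := by linarith [hτ.1, hε.2]
      have hd : 0 < |r - τ| := abs_pos.2 (sub_ne_zero.2 (Ne.symm hτr))
      have hd1 : |r - τ| ≤ 1 := abs_le.2 ⟨by linarith [hτ.2, hε.2], by linarith [hτ.1, hε.2]⟩
      have b1 : |r - τ| ^ (-γ) ≤ |r - τ| ^ (-γ') :=
        Real.rpow_le_rpow_of_exponent_ge hd hd1 (by linarith [hγ'.1])
      have b2 : τ ^ (-(1 + 2 * s)) ≤ (r / 2) ^ (-(1 + 2 * s)) :=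
        Real.rpow_le_rpow_of_nonpos (by linarith) (by linarith [hτ.1, hε.2]) (by linarith)
      have b3 : a * |r - τ| ^ (-γ) + a * |r - τ| ^ (-γ') ≤ a * (2 * |r - τ| ^ (-γ')) := by
        nlinarith
      calc _ ≤ a * (2 * |r - τ| ^ (-γ')) * (r / 2) ^ (-(1 + 2 * s)) := by gcongr
        _ = _ := by ring
  -- Here `γ' < 1` matters: the truncation error decays like `r^{-1-2s}`, no slower than the gain
  -- `r^{-γ'-2s}`.
  have hr2 : (r / 2) ^ (-(1 + 2 * s)) ≤ 2 ^ (1 + 2 * s) * (r ^ (-γ') * r ^ (-(2 * s))) := by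
    rw [Real.div_rpow hr0.le two_pos.le, Real.rpow_neg two_pos.le, div_inv_eq_mul, mul_comm]
    gcongr
    rw [← Real.rpow_add hr0]
    exact Real.rpow_le_rpow_of_exponent_le hx1.le (by linarith [hγ'.2])
  rw [hz, mul_zero, mul_zero, zero_add] at htest
  have hfu := hf _ (hpos x)
  set Q := r ^ (-γ') * r ^ (-(2 * s)) with hQ
  have hQ0 : 0 < Q := mul_pos (Real.rpow_pos_of_pos hr0 _) (Real.rpow_pos_of_pos hr0 _)
  have hεp : 0 < 4 * (ε ^ (1 - γ') / (1 - γ')) := by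
    have := Real.rpow_pos_of_pos hε.1 (1 - γ')
    positivity
  have hI : Cs s * ∫ τ in Ioo (r - ε) (r + ε),
      (a * |r - τ| ^ (-γ) + a * |r - τ| ^ (-γ')) * τ ^ (-(1 + 2 * s)) ≤
      a * Q * (Cs s * (2 ^ (1 + 2 * s) * (4 * (ε ^ (1 - γ') / (1 - γ'))))) := by
    calc _ ≤ Cs s * (a * (2 ^ (1 + 2 * s) * Q) * (4 * (ε ^ (1 - γ') / (1 - γ')))) := by
          refine mul_le_mul_of_nonneg_left (hint.trans ?_) hC.le
          gcongr
      _ = _ := by ring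
  have hfin := mul_lt_mul_of_pos_left hεsmall (mul_pos ha hQ0)
  linarith

/-- Improvement of the constant in the lower bound, using the nonlinear term. -/
lemma IsViscositySupersolution.improve_lower_bound (hk : 1 ≤ k) (hkN : k ≤ N) (hs : 0 < s)
    (hs1 : s < 1) {p : ℝ} (hp0 : 0 < p) (hu : IsViscositySupersolution k s (fun t => t ^ p) u)
    (hpos : ∀ x, 0 < u x) {γ γ' : ℝ} (hγ : γ ∈ Ioo (0 : ℝ) 1) (hγ' : γ' ∈ Ioo γ 1)
    (hz : cFun k s γ = 0) (hc : 0 < cFun k s γ') (hcrit : γ * p ≤ γ + 2 * s) {A : ℝ} (hA : 0 < A)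
    (hlow : ∃ R, ∀ y, R ≤ ‖y‖ → A * ‖y‖ ^ (-γ) ≤ u y) :
    ∃ R, ∀ y, R ≤ ‖y‖ → (A + A ^ p / (4 * cFun k s γ')) * ‖y‖ ^ (-γ) ≤ u y := by
  have hγ'1 : γ' ∈ Ioo (0 : ℝ) 1 := ⟨hγ.1.trans hγ'.1, hγ'.2⟩
  have hAp : 0 < A ^ p := Real.rpow_pos_of_pos hA p
  obtain ⟨R₁, hR₁⟩ := hlow
  set R := max R₁ 1 with hR_def
  have hR1 : 1 ≤ R := le_max_right _ _
  have hR0 : 0 < R := by linarith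
  have hlow : ∀ y, R ≤ ‖y‖ → A * ‖y‖ ^ (-γ) ≤ u y := fun y hy =>
    hR₁ y ((le_max_left _ _).trans hy)
  set η := A ^ p / (2 * cFun k s γ') with hη_def
  have hη : 0 < η := by positivity
  -- With this `B` the barrier vanishes on `‖y‖ = R` and is nonpositive inside, so `radial_test`
  -- applies with `ε = 0`.
  set B := (A + η) * R ^ (γ' - γ) with hB_def
  have hB : 0 < B := mul_pos (by linarith) (Real.rpow_pos_of_pos hR0 _)
  set v : EuclideanSpace ℝ (Fin N) → ℝ := fun y => (A + η) * ‖y‖ ^ (-γ) + -B * ‖y‖ ^ (-γ') with hv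
  have hin : ∀ y, ‖y‖ < R → v y ≤ 0 := by
    intro y hy
    rcases (norm_nonneg y).eq_or_lt with h0 | h0
    · simp only [hv]
      rw [← h0, Real.zero_rpow (by linarith [hγ.1]), Real.zero_rpow (by linarith [hγ'1.1])]
      simp
    · have b1 : ‖y‖ ^ (-γ) = ‖y‖ ^ (γ' - γ) * ‖y‖ ^ (-γ') := by
        rw [← Real.rpow_add h0]; congr 1; ring
      have b2 : ‖y‖ ^ (γ' - γ) ≤ R ^ (γ' - γ) :=
        Real.rpow_le_rpow h0.le hy.le (by linarith [hγ'.1])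
      have b3 : 0 < ‖y‖ ^ (-γ') := Real.rpow_pos_of_pos h0 _
      have b4 : (A + η) * ‖y‖ ^ (γ' - γ) ≤ B :=
        mul_le_mul_of_nonneg_left b2 (by linarith)
      simp only [hv]
      rw [b1]
      nlinarith
  have hcont : ContinuousOn v {y | R ≤ ‖y‖} := by
    have hsub : {y : EuclideanSpace ℝ (Fin N) | R ≤ ‖y‖} ⊆ {0}ᶜ := by
      rintro y hy rfl
      have : R ≤ ‖(0 : EuclideanSpace ℝ (Fin N))‖ := hy
      rw [norm_zero] at this
      linarith
    exact (continuousOn_const.mul ((continuousOn_norm_rpow γ).mono hsub)).add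
      (continuousOn_const.mul ((continuousOn_norm_rpow γ').mono hsub))
  have hvle : ∀ y, v y ≤ (A + η) * ‖y‖ ^ (-γ) := fun y => by
    have := mul_nonneg hB.le (Real.rpow_nonneg (norm_nonneg y) (-γ'))
    simp only [hv]; linarith
  have hdecay : ∀ η : ℝ, 0 < η → ∃ R, ∀ y : EuclideanSpace ℝ (Fin N), R ≤ ‖y‖ → v y < η := by
    intro ζ hζ
    obtain ⟨R₂, h₂⟩ := exists_rpow_neg_lt hγ.1 (show 0 < ζ / (A + η) by positivity)
    refine ⟨R₂, fun y hy => (hvle y).trans_lt ?_⟩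
    have := h₂ _ hy
    rwa [lt_div_iff₀ (by positivity), mul_comm] at this
  have hclaim : ∀ y, R ≤ ‖y‖ → v y ≤ u y := by
    intro z hzR
    by_contra! hlt
    obtain ⟨x, hRx, hx, hmin⟩ := exists_contact hu.1 (fun y => (hpos y).le) hcont hdecay hzR hlt
    set r := ‖x‖ with hr
    have hr1 : 1 ≤ r := hR1.trans hRx
    have hr0 : 0 < r := by linarith
    have htest := radial_test hk hkN hs hs1 hu (x := x) (r := r) (a := A + η) (b := -B)
      hr.symm le_rfl hr0 hγ hγ'1
      (fun y _ => by
        by_cases hy : R ≤ ‖y‖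
        · have := hmin y hy; simp only [hv] at this; linarith
        · have h1 := hin y (not_le.1 hy)
          have h2 := hpos y
          simp only [hv] at h1 hx
          linarith)
      (fun y hy => absurd hy (not_lt.2 (norm_nonneg y)))
    rw [sub_zero, add_zero, Ioo_self, setIntegral_empty, hz] at htest
    have hux := hlow x hRx
    have hup : A ^ p * (r ^ (-γ) * r ^ (-(2 * s))) ≤ u x ^ p := by
      have hrγ : 0 < r ^ (-γ) := Real.rpow_pos_of_pos hr0 _
      refine le_trans ?_ (Real.rpow_le_rpow (by positivity) hux hp0.le)
      rw [Real.mul_rpow hA.le hrγ.le, ← Real.rpow_mul hr0.le, ← Real.rpow_add hr0]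
      gcongr
      linarith
    -- At contact `v > u ≥ A r^{-γ}`, so the loss from the `γ'` term is less than `η c_k(γ')
    -- r^{-γ-2s}`, half of the lower bound for `u^p`.
    have hBr : B * r ^ (-γ') < η * r ^ (-γ) := by
      simp only [hv] at hx
      linarith
    have hrs : 0 < r ^ (-(2 * s)) := Real.rpow_pos_of_pos hr0 _
    have hηc : η * cFun k s γ' = A ^ p / 2 := by rw [hη_def]; field_simp
    have h3 := mul_lt_mul_of_pos_right hBr (mul_pos hrs hc)
    have h4 : η * r ^ (-γ) * (r ^ (-(2 * s)) * cFun k s γ') =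
        A ^ p / 2 * (r ^ (-γ) * r ^ (-(2 * s))) := by rw [← hηc]; ring
    have h5 : 0 < A ^ p * (r ^ (-γ) * r ^ (-(2 * s))) :=
      mul_pos hAp (mul_pos (Real.rpow_pos_of_pos hr0 _) hrs)
    linarith
  -- Far out the corrector `B‖y‖^{-γ'}` consumes at most half of the gain `η`, hence the `4` in the
  -- conclusion.
  obtain ⟨R₂, hR₂⟩ := exists_rpow_neg_lt (show 0 < γ' - γ by linarith [hγ'.1])
    (show 0 < η / (2 * B) by positivity)
  refine ⟨max R R₂, fun y hy => ?_⟩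
  have hyR : R ≤ ‖y‖ := (le_max_left _ _).trans hy
  have hy0 : 0 < ‖y‖ := by linarith
  refine le_trans ?_ (hclaim y hyR)
  have b1 := hR₂ _ ((le_max_right _ _).trans hy)
  have b2 : ‖y‖ ^ (-γ') = ‖y‖ ^ (-(γ' - γ)) * ‖y‖ ^ (-γ) := by
    rw [← Real.rpow_add hy0]; congr 1; ring
  have b3 : 0 < ‖y‖ ^ (-γ) := Real.rpow_pos_of_pos hy0 _
  rw [lt_div_iff₀ (by positivity)] at b1
  have b4 : A ^ p / (4 * cFun k s γ') = η / 2 := by rw [hη_def]; field_simp; ring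
  rw [b4]
  simp only [hv]
  rw [b2]
  nlinarith [mul_lt_mul_of_pos_right b1 b3]

/-- The gain `A^p / (4 c_k(γ'))` increases with `A`, so each iteration adds at least the first gain.
-/
lemma IsViscositySupersolution.lower_bound_unbounded (hk : 1 ≤ k) (hkN : k ≤ N) (hs : 0 < s)
    (hs1 : s < 1) {p : ℝ} (hp0 : 0 < p) (hu : IsViscositySupersolution k s (fun t => t ^ p) u)
    (hpos : ∀ x, 0 < u x) {γ γ' : ℝ} (hγ : γ ∈ Ioo (0 : ℝ) 1) (hγ' : γ' ∈ Ioo γ 1)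
    (hz : cFun k s γ = 0) (hc : 0 < cFun k s γ') (hcrit : γ * p ≤ γ + 2 * s) (A : ℝ) :
    ∃ R, ∀ y, R ≤ ‖y‖ → A * ‖y‖ ^ (-γ) ≤ u y := by
  obtain ⟨A₀, hA₀, hlow⟩ := hu.exists_lower_bound hk hkN hs hs1
    (fun t ht => Real.rpow_nonneg ht.le p) hpos hγ hγ' hz hc
  set η := A₀ ^ p / (4 * cFun k s γ') with hη_def
  have hη : 0 < η := by
    have := Real.rpow_pos_of_pos hA₀ p
    positivity
  have hmono : ∀ A B : ℝ, A ≤ B → (∃ R, ∀ y, R ≤ ‖y‖ → B * ‖y‖ ^ (-γ) ≤ u y) →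
      ∃ R, ∀ y, R ≤ ‖y‖ → A * ‖y‖ ^ (-γ) ≤ u y := fun A B hAB ⟨R, hR⟩ =>
    ⟨R, fun y hy => (mul_le_mul_of_nonneg_right hAB
      (Real.rpow_nonneg (norm_nonneg y) _)).trans (hR y hy)⟩
  have hind : ∀ n : ℕ, ∃ R, ∀ y, R ≤ ‖y‖ → (A₀ + n * η) * ‖y‖ ^ (-γ) ≤ u y := by
    intro n
    induction n with
    | zero => exact ⟨1, by simpa using hlow⟩
    | succ n ih =>
      have hge : A₀ ≤ A₀ + n * η := by
        have : 0 ≤ (n : ℝ) * η := by positivity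
        linarith
      refine hmono _ _ ?_ (hu.improve_lower_bound hk hkN hs hs1 hp0 hpos hγ hγ' hz hc hcrit
        (hA₀.trans_le hge) ih)
      have : η ≤ (A₀ + n * η) ^ p / (4 * cFun k s γ') := by
        rw [hη_def]
        gcongr
      push_cast
      linarith
  obtain ⟨n, hn⟩ := exists_nat_ge ((A - A₀) / η)
  rw [div_le_iff₀ hη] at hn
  exact hmono _ _ (by linarith) (hind n)

/-- On a fixed ball `u` has a positive minimum, which exceeds `A ρ^{-γ}` once `ρ` is large. -/
lemma exists_uniform_lower_bound (hu : LowerSemicontinuous u) (hpos : ∀ x, 0 < u x) {γ A : ℝ}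
    (hγ : 0 < γ) (hA : 0 < A) (hlow : ∃ R, ∀ y, R ≤ ‖y‖ → A * ‖y‖ ^ (-γ) ≤ u y) :
    ∃ R₀, 1 ≤ R₀ ∧ ∀ ρ, R₀ ≤ ρ → ∀ y, ‖y‖ ≤ ρ → A * ρ ^ (-γ) ≤ u y := by
  obtain ⟨R₁, hR₁⟩ := hlow
  set R := max R₁ 1 with hR
  have hR1 : 1 ≤ R := le_max_right _ _
  obtain ⟨z₀, hz₀, hzmin⟩ := LowerSemicontinuousOn.exists_isMinOn
    (s := Metric.closedBall (0 : EuclideanSpace ℝ (Fin N)) R) (f := u)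
    ⟨0, by rw [mem_closedBall_zero_iff, norm_zero]; linarith⟩
    (isCompact_closedBall _ _) (hu.lowerSemicontinuousOn _)
  obtain ⟨R₂, hR₂⟩ := exists_rpow_neg_lt hγ (show 0 < u z₀ / A from div_pos (hpos _) hA)
  refine ⟨max R R₂, hR1.trans (le_max_left _ _), fun ρ hρ y hy => ?_⟩
  by_cases hyR : R ≤ ‖y‖
  · refine le_trans ?_ (hR₁ y ((le_max_left _ _).trans hyR))
    exact mul_le_mul_of_nonneg_left
      (Real.rpow_le_rpow_of_nonpos (by linarith) hy (by linarith)) hA.le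
  · have h1 : u z₀ ≤ u y := hzmin (show y ∈ Metric.closedBall 0 R by
      rw [mem_closedBall_zero_iff]; exact (not_le.1 hyR).le)
    have h2 := hR₂ ρ ((le_max_right _ _).trans hρ)
    rw [lt_div_iff₀ hA] at h2
    linarith

end LowerBounds

end FracTrunc

namespace FracTrunc

/-! ### Nonexistence up to the critical exponent -/

section Nonexistence

variable {N k : ℕ} {s : ℝ} {u : EuclideanSpace ℝ (Fin N) → ℝ}

/-- The points given by `exists_le` with `y = 0` keep `u ≤ M`, so `u^p = u · u^{p-1} ≥ M^{p-1} u` is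
at least of order `R^{-γ}`, whereas `exists_le` makes it at most of order `R^{-2s}`; and `2s > 1 >
γ`. -/
lemma not_isViscositySupersolution_of_le_one (hk : 1 ≤ k) (hkN : k ≤ N) (hs : 1 / 2 < s)
    (hs1 : s < 1) {p : ℝ} (hp : p ≤ 1) (hpos : ∀ x, 0 < u x) {γ γ' : ℝ}
    (hγ : γ ∈ Ioo (0 : ℝ) 1) (hγ' : γ' ∈ Ioo γ 1) (hz : cFun k s γ = 0) (hc : 0 < cFun k s γ') :
    ¬IsViscositySupersolution k s (fun t => t ^ p) u := by
  intro hu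
  have hs0 : 0 < s := by linarith
  obtain ⟨A, hA, hlow⟩ := hu.exists_lower_bound hk hkN hs0 hs1
    (fun t ht => Real.rpow_nonneg ht.le p) hpos hγ hγ' hz hc
  obtain ⟨R₀, hR₀, hunif⟩ := exists_uniform_lower_bound hu.1 hpos hγ.1 hA ⟨1, hlow⟩
  set M := 4 / 3 * u 0 with hM
  have hM0 : 0 < M := by have := hpos 0; positivity
  set K := 8 / 3 * k * Cs s * minInt s * u 0 with hK
  have hL : 0 < A * 2 ^ (-γ) * M ^ (p - 1) :=
    mul_pos (mul_pos hA (Real.rpow_pos_of_pos two_pos _)) (Real.rpow_pos_of_pos hM0 _)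
  have hmain : ∀ R, R₀ ≤ R → A * 2 ^ (-γ) * M ^ (p - 1) ≤ K * R ^ (-(2 * s - γ)) := by
    intro R hR
    have hR0 : 0 < R := by linarith
    obtain ⟨x, hxR, hxM, hx⟩ := hu.exists_le hkN hs0 hs1 hpos hR0 (y := 0) (by simpa using hR0.le)
    have h1 := hunif (2 * R) (by linarith) x hxR
    have h2 : M ^ (p - 1) ≤ u x ^ (p - 1) :=
      Real.rpow_le_rpow_of_nonpos (hpos x) hxM (by linarith)
    have h3 : u x ^ p = u x * u x ^ (p - 1) := by
      have := Real.rpow_add (hpos x) 1 (p - 1)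
      rwa [Real.rpow_one, add_sub_cancel] at this
    have h4 : A * (2 * R) ^ (-γ) * M ^ (p - 1) ≤ u x ^ p := by
      rw [h3]
      exact mul_le_mul h1 h2 (Real.rpow_nonneg hM0.le _) (hpos x).le
    rw [Real.mul_rpow two_pos.le hR0.le] at h4
    have h5 := h4.trans hx
    have h6 : R ^ (-(2 * s)) = R ^ (-γ) * R ^ (-(2 * s - γ)) := by
      rw [← Real.rpow_add hR0]; congr 1; ring
    rw [h6] at h5
    have h7 : 0 < R ^ (-γ) := Real.rpow_pos_of_pos hR0 _
    refine le_of_mul_le_mul_left ?_ h7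
    rw [← hK] at h5
    linarith
  have hlim : Tendsto (fun R : ℝ => K * R ^ (-(2 * s - γ))) atTop (𝓝 0) := by
    have := (tendsto_rpow_neg_atTop (show 0 < 2 * s - γ by linarith [hγ.2])).const_mul K
    simpa using this
  obtain ⟨R, hR1, hR2⟩ := ((hlim.eventually_lt_const hL).and (eventually_ge_atTop R₀)).exists
  linarith [hmain R hR2]

/-- Consider the rescaled values `b = u(y) ρ^γ` with `‖y‖ ≤ ρ`. Passing to the point of `exists_le`
and doubling `ρ` gives `b'^p ≤ K b`, while `b' ≥ A` gives `b'^p ≥ 2K b'`. So `b' ≤ b/2`, which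
contradicts a positive infimum. -/
lemma not_isViscositySupersolution_of_one_lt (hk : 1 ≤ k) (hkN : k ≤ N) (hs : 0 < s)
    (hs1 : s < 1) {p : ℝ} (hp : 1 < p) (hpos : ∀ x, 0 < u x) {γ γ' : ℝ}
    (hγ : γ ∈ Ioo (0 : ℝ) 1) (hγ' : γ' ∈ Ioo γ 1) (hz : cFun k s γ = 0) (hc : 0 < cFun k s γ')
    (hcrit : γ * p ≤ γ + 2 * s) :
    ¬IsViscositySupersolution k s (fun t => t ^ p) u := by
  intro hu
  have hp0 : 0 < p := by linarith
  set K := max (8 / 3 * k * Cs s * minInt s * 2 ^ (γ * p)) 1 with hK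
  have hK1 : 1 ≤ K := le_max_right _ _
  set A := (2 * K) ^ (1 / (p - 1)) with hA_def
  have hA : 0 < A := Real.rpow_pos_of_pos (by linarith) _
  have hAp : A ^ (p - 1) = 2 * K := by
    rw [hA_def, ← Real.rpow_mul (by linarith), one_div_mul_cancel (by linarith), Real.rpow_one]
  obtain ⟨R₀, hR₀, hunif⟩ := exists_uniform_lower_bound hu.1 hpos hγ.1 hA
    (hu.lower_bound_unbounded hk hkN hs hs1 hp0 hpos hγ hγ' hz hc hcrit A)
  -- rescaled values of `u`
  set S : Set ℝ := {b | ∃ ρ y, R₀ ≤ ρ ∧ ‖y‖ ≤ ρ ∧ b = u y * ρ ^ γ} with hS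
  have hSA : ∀ b ∈ S, A ≤ b := by
    rintro b ⟨ρ, y, hρ, hy, rfl⟩
    have hρ0 : 0 < ρ := by linarith
    have h1 := hunif ρ hρ y hy
    have h2 : 0 < ρ ^ γ := Real.rpow_pos_of_pos hρ0 _
    have h3 : ρ ^ (-γ) * ρ ^ γ = 1 := by
      rw [← Real.rpow_add hρ0, neg_add_cancel, Real.rpow_zero]
    have := mul_le_mul_of_nonneg_right h1 h2.le
    rwa [mul_assoc, h3, mul_one] at this
  have hhalf : ∀ b ∈ S, ∃ b' ∈ S, b' ≤ b / 2 := by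
    rintro b ⟨ρ, y, hρ, hy, rfl⟩
    have hρ0 : 0 < ρ := by linarith
    obtain ⟨x, hxρ, -, hx⟩ := hu.exists_le hkN hs hs1 hpos hρ0 hy
    have hmem : u x * (2 * ρ) ^ γ ∈ S := ⟨2 * ρ, x, by linarith, hxρ, rfl⟩
    refine ⟨_, hmem, ?_⟩
    set b' := u x * (2 * ρ) ^ γ with hb'
    have hAb := hSA b' hmem
    have hb'0 : 0 < b' := hA.trans_le hAb
    have h1 : b' ^ p = u x ^ p * (2 ^ (γ * p) * ρ ^ (γ * p)) := by
      rw [hb', Real.mul_rpow (hpos x).le (by positivity), ← Real.rpow_mul (by positivity),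
        Real.mul_rpow two_pos.le hρ0.le]
    have h2 : ρ ^ (-(2 * s)) * ρ ^ (γ * p) ≤ ρ ^ γ := by
      rw [← Real.rpow_add hρ0]
      exact Real.rpow_le_rpow_of_exponent_le (by linarith) (by linarith)
    have h3 : 2 * K * b' ≤ b' ^ p := by
      have e : b' ^ p = b' ^ (p - 1) * b' := by
        rw [← Real.rpow_add_one hb'0.ne']; congr 1; ring
      rw [e, ← hAp]
      gcongr
    have hM := minInt_nonneg (s := s)
    have hC := Cs_pos hs hs1
    have huy := hpos y
    have h4 : b' ^ p ≤ K * (u y * ρ ^ γ) := by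
      rw [h1]
      have h2p : 0 < (2 : ℝ) ^ (γ * p) := Real.rpow_pos_of_pos two_pos _
      have hρp : 0 < ρ ^ (γ * p) := Real.rpow_pos_of_pos hρ0 _
      calc u x ^ p * (2 ^ (γ * p) * ρ ^ (γ * p))
          ≤ 8 / 3 * k * Cs s * minInt s * u y * ρ ^ (-(2 * s)) *
            (2 ^ (γ * p) * ρ ^ (γ * p)) := by
            gcongr
        _ = (8 / 3 * k * Cs s * minInt s * 2 ^ (γ * p)) *
            (u y * (ρ ^ (-(2 * s)) * ρ ^ (γ * p))) := by ring
        _ ≤ K * (u y * ρ ^ γ) := by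
            gcongr
            exact le_max_left _ _
    have h5 : K * (2 * b') ≤ K * (u y * ρ ^ γ) := by linarith
    have := le_of_mul_le_mul_left h5 (by linarith)
    linarith
  have hne : S.Nonempty := ⟨_, R₀, 0, le_rfl, by rw [norm_zero]; linarith, rfl⟩
  have hbdd : BddBelow S := ⟨A, hSA⟩
  have hinf : A ≤ sInf S := le_csInf hne hSA
  obtain ⟨b, hb, hlt⟩ := exists_lt_of_csInf_lt hne (show sInf S < 2 * sInf S by linarith)
  obtain ⟨b', hb', hle⟩ := hhalf b hb
  have := csInf_le hbdd hb'
  linarith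

end Nonexistence

end FracTrunc

/-! ### The Liouville-type theorem -/

theorem mainTheorem2 (N k : ℕ) (s : ℝ) (hk : 2 ≤ k) (hkN : k ≤ N) (hs : 1 / 2 < s) (hs1 : s < 1) :
    ∃ γbar ∈ Ioo (0 : ℝ) 1,
      (∀ γ ∈ Ioo (0 : ℝ) 1, FracTrunc.cFun k s γ = 0 ↔ γ = γbar) ∧
      ∀ p : ℝ,
        (∃ u : EuclideanSpace ℝ (Fin N) → ℝ,
            (∀ x, 0 ≤ u x) ∧ (∃ x, u x ≠ 0) ∧
            FracTrunc.IsViscositySupersolution k s (fun t => t ^ p) u) ↔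
          1 + 2 * s / γbar < p := by
  have hs0 : 0 < s := by linarith
  have hk1 : 1 ≤ k := by omega
  obtain ⟨γb, hγb, hz, hneg, hpos⟩ := FracTrunc.exists_cFun_zero k hk hs hs1
  refine ⟨γb, hγb, fun γ hγ => ⟨fun h => ?_, fun h => h ▸ hz⟩, fun p => ⟨?_, fun hp => ?_⟩⟩
  · rcases lt_trichotomy γ γb with hlt | heq | hgt
    · exact absurd h (hneg γ ⟨hγ.1, hlt⟩).ne
    · exact heq
    · exact absurd h (hpos γ ⟨hgt, hγ.2⟩).ne'
  · rintro ⟨u, hnn, ⟨z, hzne⟩, hu⟩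
    by_contra! hp
    have hupos := hu.pos hk1 hkN hs0 hs1 (Real.rpow_nonneg le_rfl p) hnn hzne
    -- Any exponent in `(γ̄, 1)` would serve; only the positivity of `c_k` there is used.
    have hγ' : (γb + 1) / 2 ∈ Ioo γb 1 := ⟨by linarith [hγb.2], by linarith [hγb.2]⟩
    rcases le_or_gt p 1 with h1 | h1
    · exact FracTrunc.not_isViscositySupersolution_of_le_one hk1 hkN hs hs1 h1 hupos hγb hγ' hz
        (hpos _ hγ') hu
    · refine FracTrunc.not_isViscositySupersolution_of_one_lt hk1 hkN hs0 hs1 h1 hupos hγb hγ' hz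
        (hpos _ hγ') ?_ hu
      have := mul_le_mul_of_nonneg_left hp hγb.1.le
      rwa [mul_add, mul_one, mul_div_cancel₀ _ hγb.1.ne'] at this
  · have h0 : 0 < 2 * s / γb := div_pos (by linarith) hγb.1
    have hp1 : 0 < p - 1 := by linarith
    -- The self-similar decay rate, solving `γ p = γ + 2s`; the condition on `p` says exactly that
    -- it is below `γ̄`.
    set γ := 2 * s / (p - 1) with hγ_def
    have hγ0 : 0 < γ := div_pos (by linarith) hp1
    have hγlt : γ < γb := by
      have : 2 * s / γb < p - 1 := by linarith
      rw [div_lt_iff₀ hγb.1] at this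
      rw [hγ_def, div_lt_iff₀ hp1]
      linarith
    have hγ : γ ∈ Ioo (0 : ℝ) 1 := ⟨hγ0, hγlt.trans hγb.2⟩
    have hcn := hneg γ ⟨hγ0, hγlt⟩
    refine ⟨_, fun x => (FracTrunc.bubble_pos (Real.rpow_pos_of_pos (neg_pos.2 hcn) _) γ x).le,
      ⟨0, (FracTrunc.bubble_pos (Real.rpow_pos_of_pos (neg_pos.2 hcn) _) γ 0).ne'⟩,
      FracTrunc.bubble_isViscositySupersolution hs0 hs1 hγ hcn ?_⟩
    have : γ * (p - 1) = 2 * s := by rw [hγ_def]; field_simp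
    linarith
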